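/- **Gram--Schmidt walk design.** Let $X$ be a real $n\times d$ matrix of rank $d$ with rows $x_1,\dots,x_n$, where $1\le d\le n$, let $\xi=\max_i\|x_i\|$ and $\phi\in(0,1)$, and let $\mathbf B$ be the $(n+d)\times n$ matrix obtained by stacking $\sqrt{\phi}\,I_n$ on top of $\xi^{-1}\sqrt{1-\phi}\,X^{\mathsf T}$. Here $\|\cdot\|$ is the Euclidean norm and $\|\cdot\|_\infty$ the maximum norm. Start with $z_0=0\in\mathbb R^n$ and $\mathcal A_1=\{1,\dots,n\}$. In round $t=1,\dots,n$, stop moving ($z_t=z_{t-1}$, $\mathcal A_{t+1}=\mathcal A_t$) if $\mathcal A_t=\emptyset$; otherwise: 1. If $t\ge2$ and $p_{t-1}\in\mathcal A_t$, put $p_t=p_{t-1}$; otherwise draw the pivot $p_t$ uniformly at random from $\mathcal A_t$, given the past. 2. Let $u_t$ be the minimizer of $\|\mathbf B u\|$ over all $u\in\mathbb R^n$ with $u[i]=0$ for $i\notin\mathcal A_t$ and $u[p_t]=1$. 3. Let $\Delta=\{\delta\in\mathbb R: z_{t-1}+\delta u_t\in[-1,1]^n\}$, $\delta^+=|\sup\Delta|$,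 $\delta^-=|\inf\Delta|$. Given the past and $p_t$, let $\delta_t=\delta^+$ with probability $\delta^- /(\delta^++\delta^-)$ and $\delta_t=-\delta^-$ with probability $\delta^+/(\delta^++\delta^-)$. 4. Put $z_t=z_{t-1}+\delta_tu_t$ and $\mathcal A_{t+1}=\{i\in\mathcal A_t: |z_t[i]|<1\}$. Write $z_n^{\mathrm{GSW}}$ for the resulting random vector $z_n$. **Theorem 1.3.** For all sufficiently large $n$, let $d=d_n$, $\phi=\phi_n$ and $X=X_n$ be as above, with $\phi_n$ bounded away from $0$ (that is, $c\le\phi_n<1$ for some constant $c>0$), and let $v=v_n\in\mathbb R^n$ be a nonzero vector with $v^{\mathsf T}X=0$. Put $$Y=\xi^{-1}\frac{\sqrt{1-\phi}}{\sqrt{\phi}}\,X,\qquad \kappa=\frac{n}{\lambda_{\min}(Y^{\mathsf T}Y)},$$ where $\lambda_{\min}$ denotes the smallest eigenvalue. Suppose that $$\lim_{n\to\infty} d^{1/2}\,\frac{\|v\|_\infty}{\|v\|}\,\kappa^2\log n=0 .$$ Then, as $n\to\infty$, $$\frac{\langle z_n^{\mathrm{GSW}},v\rangle}{\sqrt{\operatorname{Var}\langle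 z_n^{\mathrm{GSW}},v\rangle}}\xrightarrow{\ \mathrm{law}\ }N(0,1) \qquad\text{and}\qquad \frac{\operatorname{Var}\langle z_n^{\mathrm{GSW}},v\rangle}{\|v\|^2}\longrightarrow 1 .$$ -/

import Mathlib

open Filter Topology MeasureTheory ProbabilityTheory
open scoped ENNReal Matrix

namespace GSW

noncomputable section

/-- The Euclidean norm of a real vector. (The norm `‖x‖` of `x : Fin n → ℝ` itself is the
maximum norm.) -/
def euclNorm {ι : Type*} [Fintype ι] (x : ι → ℝ) : ℝ := ‖WithLp.toLp 2 x‖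

/-- `ξ`, the largest Euclidean norm of a row of the covariate matrix `X`. -/
def maxRowNorm {n d : ℕ} (X : Matrix (Fin n) (Fin d) ℝ) : ℝ := ⨆ i, euclNorm (X i)

/-- The `(n + d) × n` matrix obtained by stacking `√φ I_n` on top of `ξ⁻¹ √(1 - φ) Xᵀ`. -/
def augMatrix {n d : ℕ} (φ : ℝ) (X : Matrix (Fin n) (Fin d) ℝ) :
    Matrix (Fin n ⊕ Fin d) (Fin n) ℝ :=
  Matrix.fromRows (√φ • (1 : Matrix (Fin n) (Fin n) ℝ)) (((maxRowNorm X)⁻¹ * √(1 - φ)) • Xᵀ)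

/-! ### The Gram–Schmidt walk with randomized pivots -/

section Walk

variable {n : ℕ} {m : Type*} [Fintype m]

/-- `u` minimizes `‖B u‖` among the vectors that vanish outside the active set `A` and have
pivot coordinate `1`. -/
def IsStepDirection (B : Matrix m (Fin n) ℝ) (A : Finset (Fin n)) (p : Fin n)
    (u : Fin n → ℝ) : Prop :=
  ((∀ i, i ∉ A → u i = 0) ∧ u p = 1) ∧
    ∀ w : Fin n → ℝ, (∀ i, i ∉ A → w i = 0) → w p = 1 →
      euclNorm (B *ᵥ u) ≤ euclNorm (B *ᵥ w)

open Classical in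
/-- The step direction: the minimizer above (it exists and is unique when `p ∈ A` and `B` has
full column rank). -/
def stepDirection (B : Matrix m (Fin n) ℝ) (A : Finset (Fin n)) (p : Fin n) : Fin n → ℝ :=
  if h : ∃ u, IsStepDirection B A p u then h.choose else 0

/-- The set `Δ` of step sizes that keep the walk inside the cube `[-1, 1]^n`. -/
def stepSet (z u : Fin n → ℝ) : Set ℝ := {δ | ∀ i, z i + δ * u i ∈ Set.Icc (-1 : ℝ) 1}

/-- `δ⁺ = |sup Δ|`. -/
def deltaPlus (z u : Fin n → ℝ) : ℝ := |sSup (stepSet z u)|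

/-- `δ⁻ = |inf Δ|`. -/
def deltaMinus (z u : Fin n → ℝ) : ℝ := |sInf (stepSet z u)|

/-- The probability `δ⁻ / (δ⁺ + δ⁻)` of the step `δ⁺`. -/
def plusProb (z u : Fin n → ℝ) : ℝ≥0∞ :=
  ENNReal.ofReal (deltaMinus z u / (deltaPlus z u + deltaMinus z u))

theorem plusProb_le_one (z u : Fin n → ℝ) : plusProb z u ≤ 1 := by
  have h1 : 0 ≤ deltaPlus z u := abs_nonneg _
  have h2 : 0 ≤ deltaMinus z u := abs_nonneg _
  exact ENNReal.ofReal_le_one.2 (div_le_one_of_le₀ (by linarith) (by linarith))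

/-- The law of the random step size: `δ⁺` with probability `δ⁻ / (δ⁺ + δ⁻)`, and `-δ⁻` with
the complementary probability `δ⁺ / (δ⁺ + δ⁻)`. -/
def stepSizeLaw (z u : Fin n → ℝ) : PMF ℝ :=
  (PMF.ofFintype (fun b : Bool => cond b (plusProb z u) (1 - plusProb z u))
    (by simp [plusProb_le_one])).map
    fun b => cond b (deltaPlus z u) (-deltaMinus z u)

/-- The state between two rounds: the fractional assignment, the active set, and the pivot of the
preceding round (`none` before the first round). -/
structure State (n : ℕ) where
  /-- the fractional assignment -/
  z : Fin n → ℝ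
  /-- the active set -/
  active : Finset (Fin n)
  /-- the last pivot -/
  pivot : Option (Fin n)

/-- The walk starts at `0` with every coordinate active. -/
def initState (n : ℕ) : State n := ⟨0, Finset.univ, none⟩

open Classical in
/-- The pivot of the next round: the last pivot as long as it is active, and otherwise a uniformly
random active index. -/
def pivotLaw (s : State n) (h : s.active.Nonempty) : PMF (Fin n) :=
  if hp : ∃ p ∈ s.active, s.pivot = some p then PMF.pure hp.choose
  else PMF.uniformOfFinset s.active h

open Classical in
/-- The state after a round with pivot `p` and step size `δ` along `u`: the assignment moves to
`z + δ u`, and the active coordinates that reached `±1` are frozen. -/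
def updateState (s : State n) (p : Fin n) (u : Fin n → ℝ) (δ : ℝ) : State n :=
  ⟨s.z + δ • u, s.active.filter fun i => |(s.z + δ • u) i| < 1, some p⟩

open Classical in
/-- The law of the state after one round. Nothing moves once no coordinate is active. -/
def stepLaw (B : Matrix m (Fin n) ℝ) (s : State n) : PMF (State n) :=
  if h : s.active.Nonempty then
    (pivotLaw s h).bind fun p =>
      (stepSizeLaw s.z (stepDirection B s.active p)).map
        (updateState s p (stepDirection B s.active p))
  else PMF.pure s

/-- The law of the state after `t` rounds. -/
def stateLaw (B : Matrix m (Fin n) ℝ) : ℕ → PMF (State n)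
  | 0 => PMF.pure (initState n)
  | t + 1 => (stateLaw B t).bind (stepLaw B)

end Walk

/-- The law on `ℝ^n` of the design vector `z_n`, the assignment after `n` rounds of the
Gram–Schmidt walk with covariates `X` and robustness parameter `φ`. -/
def designLaw {n d : ℕ} (φ : ℝ) (X : Matrix (Fin n) (Fin d) ℝ) : Measure (Fin n → ℝ) :=
  ((stateLaw (augMatrix φ X) n).map State.z).toMeasure

instance {n d : ℕ} (φ : ℝ) (X : Matrix (Fin n) (Fin d) ℝ) :
    IsProbabilityMeasure (designLaw φ X) := by
  unfold designLaw
  infer_instance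

/-- `Var ⟨z_n, v⟩`. -/
def designVar {n d : ℕ} (φ : ℝ) (X : Matrix (Fin n) (Fin d) ℝ) (v : Fin n → ℝ) : ℝ :=
  variance (fun z : Fin n → ℝ => z ⬝ᵥ v) (designLaw φ X)

/-! ### The condition number -/

/-- `Y = ξ⁻¹ (√(1 - φ) / √φ) X`. -/
def scaledCov {n d : ℕ} (φ : ℝ) (X : Matrix (Fin n) (Fin d) ℝ) : Matrix (Fin n) (Fin d) ℝ :=
  ((maxRowNorm X)⁻¹ * (√(1 - φ) / √φ)) • X

/-- The smallest eigenvalue of a real symmetric matrix. -/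
def lambdaMin {d : ℕ} (M : Matrix (Fin d) (Fin d) ℝ) : ℝ := sInf (spectrum ℝ M)

/-- `κ = n / λ_min(Yᵀ Y)`. -/
def kappa {n d : ℕ} (φ : ℝ) (X : Matrix (Fin n) (Fin d) ℝ) : ℝ :=
  n / lambdaMin ((scaledCov φ X)ᵀ * scaledCov φ X)

end

end GSW

/-!
The pairing of the walk with `v` is a martingale, and the proof compares it round by round with a
Gaussian whose variance is spent at the right rate.

Write `Y` for the scaled covariates, so that `‖B w‖²` is a multiple of `wᵀ (I + Y Yᵀ) w`
(`covForm`). For an active set `A` let `R(A) = v_Aᵀ (I + Y_A Y_Aᵀ)⁻¹ v_A` (`residualVar`). By one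
step of Gram–Schmidt, `R(A) - R(A \ {p}) = ⟨u, v⟩² / q`, where `u` is the step direction with pivot
`p` and `q = covForm u u ≥ 1` (`IsPivotDirection.residualVar_erase`). Moreover `R` of the full set is
`‖v‖²` because `vᵀ Y = 0`, and `R(A) ≤ ‖v_A‖²`.

Call a state good if `Y_Aᵀ Y_A` is comparable to its expectation under uniform sampling and the
active coordinates of `z` are small. From a good state without an active pivot, the non-pivot
coordinates of `u` are tiny, so the next step takes the pivot to `±1` and freezes no other coordinate
(`IsFree.stepMean_eq`); moreover `q` is close to `1` and the increment is small and has variance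
close to `R(A) - R(A \ {p})`. Hence `exp (i θ ⟨z, v⟩ - θ² R(A) / 2)` and `⟨z, v⟩² + R(A)` are almost
invariant under the Markov operator of the walk, with errors that telescope against `R`. Since the
pivots are then drawn without replacement, two explicit supermartingales bound the cost of bad
states: the squared Frobenius deviation of the empirical second-moment matrix of the active rows, and
a fourth-moment potential for the drift of the active coordinates (`badPotential`). The comparison
principle `WalkBounds.norm_iterate_sub_le` combines these by backward induction on the number of
active coordinates, without stopping times.

The comparison stops when a small proportion `ε` of the coordinates is active. The remaining rounds
contribute little, because from every state the variance still to come is at most a constant times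
`R(A) ≤ ‖v_A‖²` (`iterate_stepMean_sq_le`), and a random set of proportion `ε` carries about
`ε ‖v‖²`.

Only two consequences of the growth condition enter: `κ² / √n → 0`, which makes the bad states
negligible, and `‖v‖_∞ / ‖v‖ → 0`, which makes the increments small. Lévy's continuity theorem
finishes the proof.
-/

namespace GSW

noncomputable section

/-! ### The quadratic form of the walk, step directions and residual variance -/

section LinearAlgebra

variable {n d : ℕ}

/-- The bilinear form `aᵀ (I + Y Yᵀ) b`. Up to the factor `φ` this is `⟨B a, B b⟩`. -/
def covForm (Y : Matrix (Fin n) (Fin d) ℝ) (a b : Fin n → ℝ) : ℝ :=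
  a ⬝ᵥ b + (a ᵥ* Y) ⬝ᵥ (b ᵥ* Y)

variable (Y : Matrix (Fin n) (Fin d) ℝ)

theorem covForm_comm (a b : Fin n → ℝ) : covForm Y a b = covForm Y b a := by
  simp [covForm, dotProduct_comm]

theorem covForm_add_left (a b c : Fin n → ℝ) :
    covForm Y (a + b) c = covForm Y a c + covForm Y b c := by
  simp [covForm, Matrix.add_vecMul, add_dotProduct]; ring

theorem covForm_smul_left (t : ℝ) (a c : Fin n → ℝ) :
    covForm Y (t • a) c = t * covForm Y a c := by
  simp [covForm, Matrix.smul_vecMul, smul_dotProduct]; ring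

theorem covForm_add_right (a b c : Fin n → ℝ) :
    covForm Y a (b + c) = covForm Y a b + covForm Y a c := by
  simp [covForm_comm Y a, covForm_add_left]

theorem covForm_smul_right (t : ℝ) (a c : Fin n → ℝ) :
    covForm Y a (t • c) = t * covForm Y a c := by
  simp [covForm_comm Y a, covForm_smul_left]

theorem dotProduct_self_nonneg_real {ι : Type*} [Fintype ι] (a : ι → ℝ) : 0 ≤ a ⬝ᵥ a :=
  Finset.sum_nonneg fun i _ => mul_self_nonneg (a i)

theorem dotProduct_self_le_covForm (a : Fin n → ℝ) : a ⬝ᵥ a ≤ covForm Y a a := by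
  have := dotProduct_self_nonneg_real (a ᵥ* Y)
  unfold covForm; linarith

theorem covForm_self_nonneg (a : Fin n → ℝ) : 0 ≤ covForm Y a a :=
  (dotProduct_self_nonneg_real a).trans (dotProduct_self_le_covForm Y a)

theorem eq_zero_of_covForm_self_eq_zero {a : Fin n → ℝ} (h : covForm Y a a = 0) : a = 0 := by
  have h1 := dotProduct_self_le_covForm Y a
  have h2 := dotProduct_self_nonneg_real a
  exact dotProduct_self_eq_zero.1 (le_antisymm (by linarith) h2)

/-- The optimality condition for the step direction with active set `A` and pivot `p`. -/
def IsPivotDirection (A : Finset (Fin n)) (p : Fin n) (u : Fin n → ℝ) : Prop :=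
  (∀ i, i ∉ A → u i = 0) ∧ u p = 1 ∧
    ∀ w : Fin n → ℝ, (∀ i, i ∉ A.erase p → w i = 0) → covForm Y u w = 0

/-- The Riesz representation of a functional on the vectors supported on `A`, by Gram–Schmidt. -/
theorem exists_representer (A : Finset (Fin n)) (ℓ : (Fin n → ℝ) →ₗ[ℝ] ℝ) :
    ∃ g : Fin n → ℝ, (∀ i, i ∉ A → g i = 0) ∧
      ∀ w : Fin n → ℝ, (∀ i, i ∉ A → w i = 0) → covForm Y g w = ℓ w := by
  induction A using Finset.induction_on generalizing ℓ with
  | empty =>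
    refine ⟨0, by simp, fun w hw => ?_⟩
    have : w = 0 := by ext i; exact hw i (by simp)
    simp [this, covForm]
  | insert p A hp ih =>
    obtain ⟨e, he, heA⟩ := ih
      { toFun := fun w => covForm Y (Pi.single p 1) w
        map_add' := covForm_add_right Y _
        map_smul' := fun t w => by simp [covForm_smul_right] }
    obtain ⟨g, hg, hgA⟩ := ih ℓ
    set u : Fin n → ℝ := Pi.single p 1 + (-1 : ℝ) • e with hu
    have hup : u p = 1 := by simp [hu, he p hp]
    have huA : ∀ i, i ∉ insert p A → u i = 0 := by
      intro i hi
      simp only [Finset.mem_insert, not_or] at hi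
      simp [hu, he i hi.2, hi.1]
    have hort : ∀ w : Fin n → ℝ, (∀ i, i ∉ A → w i = 0) → covForm Y u w = 0 := by
      intro w hw
      have := heA w hw
      simp only [LinearMap.coe_mk, AddHom.coe_mk] at this
      rw [hu, covForm_add_left, covForm_smul_left, this]; ring
    have hq : covForm Y u u ≠ 0 := by
      intro h
      have := eq_zero_of_covForm_self_eq_zero Y h
      rw [this] at hup; simp at hup
    clear_value u
    refine ⟨g + (ℓ u / covForm Y u u) • u, ?_, ?_⟩
    · intro i hi
      have hi' := hi
      simp only [Finset.mem_insert, not_or] at hi'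
      simp [hg i hi'.2, huA i hi]
    · intro w hw
      have hw' : ∀ i, i ∉ A → (w - w p • u) i = 0 := by
        intro i hi
        by_cases hip : i = p
        · subst hip; simp [hup]
        · have : i ∉ insert p A := by simp [hip, hi]
          simp [hw i this, huA i this]
      have h1 := hgA _ hw'
      have h2 := hort _ hw'
      have h3 := hort g hg
      have hdec : w = (w - w p • u) + w p • u := by simp
      rw [hdec, covForm_add_right, covForm_add_left, covForm_add_left, covForm_smul_right,
        covForm_smul_right, covForm_smul_left, covForm_smul_left, h1, h2, covForm_comm Y g u, h3,
        map_add, map_smul]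
      rw [map_sub, map_smul, smul_eq_mul]
      field_simp
      ring

theorem exists_isPivotDirection {A : Finset (Fin n)} {p : Fin n} (hp : p ∈ A) :
    ∃ u, IsPivotDirection Y A p u := by
  obtain ⟨e, he, heA⟩ := exists_representer Y (A.erase p)
      { toFun := fun w => covForm Y (Pi.single p 1) w
        map_add' := covForm_add_right Y _
        map_smul' := fun t w => by simp [covForm_smul_right] }
  refine ⟨Pi.single p 1 + (-1 : ℝ) • e, ?_, ?_, ?_⟩
  · intro i hi
    have h1 : i ≠ p := fun h => hi (h ▸ hp)
    have h2 : i ∉ A.erase p := fun h => hi (Finset.mem_of_mem_erase h)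
    simp [h1, he i h2]
  · simp [he p (by simp)]
  · intro w hw
    have := heA w hw
    simp only [LinearMap.coe_mk, AddHom.coe_mk] at this
    rw [covForm_add_left, covForm_smul_left, this]; ring

variable {Y}

/-- On the vectors supported on `A`, the form against `u` only sees the pivot coordinate. -/
theorem IsPivotDirection.covForm_eq {A : Finset (Fin n)} {p : Fin n} {u w : Fin n → ℝ}
    (hu : IsPivotDirection Y A p u) (hw : ∀ i, i ∉ A → w i = 0) :
    covForm Y u w = w p * covForm Y u u := by
  have hw' : ∀ i, i ∉ A.erase p → (w - w p • u) i = 0 := by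
    intro i hi
    by_cases hip : i = p
    · subst hip; simp [hu.2.1]
    · have : i ∉ A := fun h => hi (Finset.mem_erase.2 ⟨hip, h⟩)
      simp [hw i this, hu.1 i this]
  have h2 := hu.2.2 _ hw'
  have hdec : w = (w - w p • u) + w p • u := by simp
  rw [hdec, covForm_add_right, covForm_smul_right, h2]
  simp [hu.2.1]

theorem IsPivotDirection.one_le {A : Finset (Fin n)} {p : Fin n} {u : Fin n → ℝ}
    (hu : IsPivotDirection Y A p u) : 1 ≤ covForm Y u u := by
  refine le_trans ?_ (dotProduct_self_le_covForm Y u)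
  have : u p * u p ≤ u ⬝ᵥ u :=
    Finset.single_le_sum (f := fun i => u i * u i) (fun i _ => mul_self_nonneg (u i))
      (Finset.mem_univ p)
  simpa [hu.2.1] using this

/-- Pythagoras: every competitor exceeds the pivot direction by the energy of the difference. -/
theorem IsPivotDirection.covForm_self_eq {A : Finset (Fin n)} {p : Fin n} {u w : Fin n → ℝ}
    (hu : IsPivotDirection Y A p u) (hw : ∀ i, i ∉ A → w i = 0) (hwp : w p = 1) :
    covForm Y w w = covForm Y u u + covForm Y (w + (-1 : ℝ) • u) (w + (-1 : ℝ) • u) := by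
  have h := hu.covForm_eq hw
  simp only [covForm_add_left, covForm_add_right, covForm_smul_left, covForm_smul_right,
    covForm_comm Y w u, h, hwp]
  ring

theorem euclNorm_sq {ι : Type*} [Fintype ι] (x : ι → ℝ) : euclNorm x ^ 2 = x ⬝ᵥ x := by
  rw [euclNorm, EuclideanSpace.norm_sq_eq, dotProduct]
  exact Finset.sum_congr rfl fun i _ => by simp [sq]

theorem euclNorm_nonneg {ι : Type*} [Fintype ι] (x : ι → ℝ) : 0 ≤ euclNorm x := norm_nonneg _

/-- When `‖B w‖²` is a positive multiple of `covForm Y w w`, the step direction exists, is unique,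
and satisfies the optimality condition. -/
theorem isPivotDirection_stepDirection {m : Type*} [Fintype m] {B : Matrix m (Fin n) ℝ} {c : ℝ}
    (hc : 0 < c) (hB : ∀ w, euclNorm (B *ᵥ w) ^ 2 = c * covForm Y w w)
    {A : Finset (Fin n)} {p : Fin n} (hp : p ∈ A) :
    IsPivotDirection Y A p (stepDirection B A p) := by
  obtain ⟨u, hu⟩ := exists_isPivotDirection Y hp
  have hle : ∀ w w', euclNorm (B *ᵥ w) ≤ euclNorm (B *ᵥ w') ↔ covForm Y w w ≤ covForm Y w' w' := by
    intro w w'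
    rw [← sq_le_sq₀ (euclNorm_nonneg _) (euclNorm_nonneg _), hB, hB, mul_le_mul_iff_right₀ hc]
  have hex : ∃ u, IsStepDirection B A p u := by
    refine ⟨u, ⟨hu.1, hu.2.1⟩, fun w hw hwp => (hle _ _).2 ?_⟩
    rw [hu.covForm_self_eq hw hwp]
    linarith [covForm_self_nonneg Y (w + (-1 : ℝ) • u)]
  have hs : stepDirection B A p = hex.choose := by rw [stepDirection, dif_pos hex]
  have hspec := hex.choose_spec
  rw [← hs] at hspec
  have h1 := (hle _ _).1 (hspec.2 u hu.1 hu.2.1)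
  rw [hu.covForm_self_eq hspec.1.1 hspec.1.2] at h1
  have h2 := eq_zero_of_covForm_self_eq_zero Y
    (le_antisymm (by linarith) (covForm_self_nonneg Y (stepDirection B A p + (-1 : ℝ) • u)))
  have h3 : stepDirection B A p = u := by
    have := eq_neg_of_add_eq_zero_left h2
    simpa using this
  rwa [h3]

variable (Y)

/-- The vector supported on `A` that represents `w ↦ ⟨v, w⟩` there with respect to `covForm`. -/
def representer (v : Fin n → ℝ) (A : Finset (Fin n)) : Fin n → ℝ :=
  (exists_representer Y A (dotProductBilin ℝ ℝ v)).choose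

theorem representer_supp (v : Fin n → ℝ) (A : Finset (Fin n)) {i : Fin n} (hi : i ∉ A) :
    representer Y v A i = 0 :=
  (exists_representer Y A (dotProductBilin ℝ ℝ v)).choose_spec.1 i hi

theorem covForm_representer (v : Fin n → ℝ) (A : Finset (Fin n)) {w : Fin n → ℝ}
    (hw : ∀ i, i ∉ A → w i = 0) : covForm Y (representer Y v A) w = v ⬝ᵥ w := by
  exact (exists_representer Y A (dotProductBilin ℝ ℝ v)).choose_spec.2 w hw

/-- `v_Aᵀ (I + Y_A Y_Aᵀ)⁻¹ v_A`, the proxy for the variance of `⟨z, v⟩` still to be generated when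
`A` is the active set. -/
def residualVar (v : Fin n → ℝ) (A : Finset (Fin n)) : ℝ :=
  covForm Y (representer Y v A) (representer Y v A)

theorem residualVar_eq (v : Fin n → ℝ) (A : Finset (Fin n)) :
    residualVar Y v A = v ⬝ᵥ representer Y v A :=
  covForm_representer Y v A fun _ hi => representer_supp Y v A hi

theorem residualVar_nonneg (v : Fin n → ℝ) (A : Finset (Fin n)) : 0 ≤ residualVar Y v A :=
  covForm_self_nonneg Y _

/-- The variational characterization of `residualVar`. -/
theorem le_residualVar (v : Fin n → ℝ) (A : Finset (Fin n)) {w : Fin n → ℝ}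
    (hw : ∀ i, i ∉ A → w i = 0) : 2 * (v ⬝ᵥ w) - covForm Y w w ≤ residualVar Y v A := by
  have h := covForm_self_nonneg Y (representer Y v A + (-1 : ℝ) • w)
  simp only [covForm_add_left, covForm_add_right, covForm_smul_left, covForm_smul_right,
    covForm_comm Y w (representer Y v A), covForm_representer Y v A hw] at h
  unfold residualVar
  linarith

theorem residualVar_mono (v : Fin n → ℝ) {A A' : Finset (Fin n)} (h : A' ⊆ A) :
    residualVar Y v A' ≤ residualVar Y v A := by
  have := le_residualVar Y v A (w := representer Y v A')
    fun i hi => representer_supp Y v A' fun h' => hi (h h')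
  have h2 := residualVar_eq Y v A'
  have h3 : covForm Y (representer Y v A') (representer Y v A') = residualVar Y v A' := rfl
  linarith

theorem residualVar_le_sum (v : Fin n → ℝ) (A : Finset (Fin n)) :
    residualVar Y v A ≤ ∑ i ∈ A, v i ^ 2 := by
  set g := representer Y v A with hg
  have h1 : v ⬝ᵥ g = ∑ i ∈ A, v i * g i :=
    (Finset.sum_subset (Finset.subset_univ A) fun i _ hi => by
      rw [hg, representer_supp Y v A hi, mul_zero]).symm
  have h2 : g ⬝ᵥ g = ∑ i ∈ A, g i * g i :=
    (Finset.sum_subset (Finset.subset_univ A) fun i _ hi => by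
      rw [hg, representer_supp Y v A hi, mul_zero]).symm
  have h3 := dotProduct_self_le_covForm Y g
  have h4 : covForm Y g g = residualVar Y v A := rfl
  have h5 := residualVar_eq Y v A
  have h6 : ∑ i ∈ A, (2 * (v i * g i) - g i * g i) ≤ ∑ i ∈ A, v i ^ 2 :=
    Finset.sum_le_sum fun i _ => by nlinarith [sq_nonneg (v i - g i)]
  rw [Finset.sum_sub_distrib, ← Finset.mul_sum] at h6
  linarith

theorem residualVar_univ {v : Fin n → ℝ} (hv : v ᵥ* Y = 0) :
    residualVar Y v Finset.univ = v ⬝ᵥ v := by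
  refine le_antisymm ((residualVar_le_sum Y v _).trans_eq ?_) ?_
  · simp [dotProduct, sq]
  · have := le_residualVar Y v Finset.univ (w := v) (by simp)
    have h2 : covForm Y v v = v ⬝ᵥ v := by simp [covForm, hv]
    linarith

variable {Y}

/-- Removing the pivot from the active set lowers `residualVar` by the energy of `v` along the
step direction: one step of Gram–Schmidt. -/
theorem IsPivotDirection.residualVar_erase {A : Finset (Fin n)} {p : Fin n} {u : Fin n → ℝ}
    (hu : IsPivotDirection Y A p u) (hp : p ∈ A) (v : Fin n → ℝ) :
    (v ⬝ᵥ u) ^ 2 = covForm Y u u * (residualVar Y v A - residualVar Y v (A.erase p)) := by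
  set g := representer Y v A with hg
  set g' := representer Y v (A.erase p) with hg'
  have hgs : ∀ i, i ∉ A → g i = 0 := fun i hi => representer_supp Y v A hi
  have hgs' : ∀ i, i ∉ A.erase p → g' i = 0 := fun i hi => representer_supp Y v _ hi
  have hgs'' : ∀ i, i ∉ A → g' i = 0 :=
    fun i hi => hgs' i fun h => hi (Finset.mem_of_mem_erase h)
  have h1 : v ⬝ᵥ u = g p * covForm Y u u := by
    rw [← covForm_representer Y v A hu.1, covForm_comm, hu.covForm_eq hgs]
  have hd : ∀ i, i ∉ A.erase p → (g + (-(g p)) • u) i = 0 := by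
    intro i hi
    by_cases hip : i = p
    · subst hip; simp [hu.2.1]
    · have : i ∉ A := fun h => hi (Finset.mem_erase.2 ⟨hip, h⟩)
      simp [hgs i this, hu.1 i this]
  have h2 : residualVar Y v (A.erase p) = v ⬝ᵥ g' := residualVar_eq Y v _
  have h3 : residualVar Y v A = v ⬝ᵥ g := residualVar_eq Y v _
  have h4 := covForm_representer Y v (A.erase p) hd
  have h5 := covForm_representer Y v A hgs''
  have h6 : covForm Y u g' = 0 := hu.2.2 _ hgs'
  rw [← hg'] at h4
  rw [← hg] at h5
  rw [covForm_add_right, covForm_smul_right, covForm_comm Y g' u, h6, covForm_comm Y g' g, h5,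
    dotProduct_add, dotProduct_smul] at h4
  simp only [smul_eq_mul] at h4
  rw [h2, h3, h1]
  rw [h1] at h4
  linear_combination (covForm Y u u) * h4

section Bounds

variable {A : Finset (Fin n)} {p : Fin n} {u : Fin n → ℝ}

theorem IsPivotDirection.coord_eq (hu : IsPivotDirection Y A p u) {j : Fin n} (hj : j ∈ A)
    (hjp : j ≠ p) : u j = -(Y j ⬝ᵥ (u ᵥ* Y)) := by
  have h := hu.2.2 (Pi.single j 1) (by
    intro i hi
    have : i ≠ j := fun h => hi (h ▸ Finset.mem_erase.2 ⟨hjp, hj⟩)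
    simp [this])
  simp only [covForm, dotProduct_single, mul_one, Matrix.single_one_vecMul] at h
  rw [dotProduct_comm]
  have h' : (u ᵥ* Y) ⬝ᵥ Y j = (u ᵥ* Y) ⬝ᵥ Y.row j := rfl
  linarith

theorem IsPivotDirection.covForm_self_eq_one_add (hu : IsPivotDirection Y A p u) (hp : p ∈ A) :
    covForm Y u u = 1 + Y p ⬝ᵥ (u ᵥ* Y) := by
  have h := hu.covForm_eq (w := Pi.single p 1) (by
    intro i hi
    have : i ≠ p := fun h => hi (h ▸ hp)
    simp [this])
  simp only [covForm, dotProduct_single, mul_one, Matrix.single_one_vecMul] at h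
  simp only [Pi.single_eq_same, one_mul, hu.2.1] at h
  unfold covForm
  rw [← h, dotProduct_comm]; rfl

/-- The normal equation for `h = uᵀ Y`. -/
theorem IsPivotDirection.normal_eq (hu : IsPivotDirection Y A p u) (hp : p ∈ A) :
    (u ᵥ* Y) ⬝ᵥ (u ᵥ* Y) + ∑ j ∈ A.erase p, (Y j ⬝ᵥ (u ᵥ* Y)) ^ 2 = Y p ⬝ᵥ (u ᵥ* Y) := by
  have h1 : (u ᵥ* Y) ⬝ᵥ (u ᵥ* Y) = ∑ j ∈ A, u j * (Y j ⬝ᵥ (u ᵥ* Y)) := by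
    rw [← Matrix.dotProduct_mulVec]
    exact (Finset.sum_subset (Finset.subset_univ A) fun i _ hi => by simp [hu.1 i hi]).symm
  rw [h1, ← Finset.add_sum_erase _ _ hp, hu.2.1, one_mul, add_assoc, ← Finset.sum_add_distrib,
    Finset.sum_eq_zero, add_zero]
  intro j hj
  rw [hu.coord_eq (Finset.mem_of_mem_erase hj) (Finset.ne_of_mem_erase hj)]
  ring

theorem dotProduct_sq_le {ι : Type*} [Fintype ι] (a b : ι → ℝ) :
    (a ⬝ᵥ b) ^ 2 ≤ (a ⬝ᵥ a) * (b ⬝ᵥ b) := by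
  have := Finset.sum_mul_sq_le_sq_mul_sq Finset.univ a b
  simpa [dotProduct, sq] using this

theorem IsPivotDirection.covForm_self_le {r : ℝ} (hu : IsPivotDirection Y A p u) (hp : p ∈ A)
    (hr : Y p ⬝ᵥ Y p ≤ r ^ 2) : covForm Y u u ≤ 1 + r ^ 2 := by
  have h := hu.covForm_self_eq (w := Pi.single p 1) (by
    intro i hi
    have : i ≠ p := fun h => hi (h ▸ hp)
    simp [this]) (by simp)
  have h2 := covForm_self_nonneg Y (Pi.single p 1 + (-1 : ℝ) • u)
  have h3 : covForm Y (Pi.single p 1) (Pi.single p 1) = 1 + Y p ⬝ᵥ Y p := by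
    simp only [covForm, dotProduct_single, mul_one, Matrix.single_one_vecMul]
    simp; rfl
  linarith

/-- If the active rows of `Y` satisfy a lower frame bound `lam ≥ 2 r²`, then `h = uᵀ Y` is small:
`‖h‖ ≤ 2 r / lam`. -/
theorem IsPivotDirection.euclNorm_vecMul_le {r lam : ℝ} (hu : IsPivotDirection Y A p u) (hp : p ∈ A)
    (hr0 : 0 ≤ r) (hr : Y p ⬝ᵥ Y p ≤ r ^ 2) (hlam : 2 * r ^ 2 ≤ lam) (hlam0 : 0 < lam)
    (hA : ∀ x : Fin d → ℝ, lam * (x ⬝ᵥ x) ≤ ∑ i ∈ A, (Y i ⬝ᵥ x) ^ 2) :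
    euclNorm (u ᵥ* Y) ≤ 2 * r / lam := by
  set h := u ᵥ* Y with hh
  have h1 := hu.normal_eq hp
  rw [← hh] at h1
  have h2 := hA h
  rw [← Finset.add_sum_erase _ _ hp] at h2
  have h3 : (Y p ⬝ᵥ h) ^ 2 ≤ (r * euclNorm h) ^ 2 := by
    rw [mul_pow, euclNorm_sq]
    exact (dotProduct_sq_le _ _).trans (mul_le_mul_of_nonneg_right hr (dotProduct_self_nonneg_real h))
  have hn : 0 ≤ euclNorm h := norm_nonneg _
  have h4 : Y p ⬝ᵥ h ≤ r * euclNorm h := le_of_sq_le_sq h3 (by positivity)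
  rw [← euclNorm_sq] at h1 h2
  rw [le_div_iff₀ hlam0]
  by_contra! hcon
  have h5 : 0 < euclNorm h := by
    by_contra! h0
    have : euclNorm h = 0 := le_antisymm h0 hn
    rw [this] at hcon; linarith
  nlinarith [mul_le_mul_of_nonneg_right hlam (sq_nonneg (euclNorm h)),
    mul_lt_mul_of_pos_right hcon h5]

end Bounds

end LinearAlgebra

/-! ### The Markov operator of one round -/

section FiniteMean

variable {α β E : Type*} [NormedAddCommGroup E] [NormedSpace ℝ E]

/-- The expectation of `f` under a probability mass function, used for finitely supported laws. -/
def pmfMean (p : PMF α) (f : α → E) : E := ∑' a, (p a).toReal • f a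

theorem pmfMean_eq_sum {p : PMF α} {S : Finset α} (hS : ∀ a, a ∉ S → p a = 0) (f : α → E) :
    pmfMean p f = ∑ a ∈ S, (p a).toReal • f a :=
  tsum_eq_sum fun a ha => by simp [hS a ha]

theorem pmfMean_pure (a : α) (f : α → E) : pmfMean (PMF.pure a) f = f a := by
  classical
  rw [pmfMean_eq_sum (S := {a}) (fun b hb => by
    rw [PMF.pure_apply, if_neg (by simpa using hb)])]
  simp [PMF.pure_apply]

theorem pmfMean_bind {p : PMF α} {k : α → PMF β} (hp : p.support.Finite)
    (hk : ∀ a ∈ p.support, (k a).support.Finite) (f : β → E) :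
    pmfMean (p.bind k) f = pmfMean p fun a => pmfMean (k a) f := by
  classical
  set S := hp.toFinset with hS
  have hS0 : ∀ a, a ∉ S → p a = 0 := by
    intro a ha
    simpa [hS, PMF.mem_support_iff] using ha
  have hU : (⋃ a ∈ p.support, (k a).support).Finite := hp.biUnion hk
  set U := hU.toFinset with hUdef
  have hU0 : ∀ a ∈ S, ∀ b, b ∉ U → k a b = 0 := by
    intro a ha b hb
    by_contra hne
    refine hb (hU.mem_toFinset.2 (Set.mem_biUnion (hp.mem_toFinset.1 ha) ?_))
    exact (PMF.mem_support_iff _ _).2 hne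
  have hbind : ∀ b, (p.bind k) b = ∑ a ∈ S, p a * k a b := by
    intro b
    rw [PMF.bind_apply]
    exact tsum_eq_sum fun a ha => by simp [hS0 a ha]
  rw [pmfMean_eq_sum (S := U), pmfMean_eq_sum hS0]
  · have h1 : ∀ a ∈ S, (p a).toReal • pmfMean (k a) f
        = ∑ b ∈ U, ((p a).toReal * (k a b).toReal) • f b := by
      intro a ha
      rw [pmfMean_eq_sum (hU0 a ha), Finset.smul_sum]
      simp [mul_smul]
    rw [Finset.sum_congr rfl h1, Finset.sum_comm]
    refine Finset.sum_congr rfl fun b _ => ?_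
    rw [← Finset.sum_smul, hbind, ENNReal.toReal_sum]
    · simp
    · exact fun a _ => ENNReal.mul_ne_top (PMF.apply_ne_top _ _) (PMF.apply_ne_top _ _)
  · intro b hb
    rw [hbind]
    exact Finset.sum_eq_zero fun a ha => by simp [hU0 a ha b hb]

theorem support_bind_finite {p : PMF α} {k : α → PMF β} (hp : p.support.Finite)
    (hk : ∀ a ∈ p.support, (k a).support.Finite) : (p.bind k).support.Finite := by
  rw [PMF.support_bind]
  exact hp.biUnion hk

theorem support_map_finite {p : PMF α} (g : α → β) (hp : p.support.Finite) :
    (p.map g).support.Finite := by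
  rw [PMF.support_map]
  exact hp.image g

theorem pmfMean_map {p : PMF α} (g : α → β) (hp : p.support.Finite) (f : β → E) :
    pmfMean (p.map g) f = pmfMean p (f ∘ g) := by
  rw [← PMF.bind_pure_comp, pmfMean_bind hp fun a _ => by
    simp only [Function.comp, PMF.support_pure]; exact Set.finite_singleton _]
  simp [pmfMean_pure, Function.comp_def]

theorem integral_toMeasure_eq_pmfMean [MeasurableSpace α] [MeasurableSingletonClass α]
    [CompleteSpace E] {p : PMF α} (hp : p.support.Finite) {f : α → E}
    (hf : AEStronglyMeasurable f p.toMeasure) :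
    ∫ a, f a ∂p.toMeasure = pmfMean p f := by
  refine PMF.integral_eq_tsum p f ?_
  obtain ⟨C, hC⟩ := (hp.image fun a => ‖f a‖).bddAbove
  refine Integrable.of_bound hf C ?_
  have : p.support ∈ ae p.toMeasure := by
    rw [mem_ae_iff, PMF.toMeasure_apply_eq_zero_iff _ (p.support_countable.measurableSet.compl)]
    exact disjoint_compl_right
  filter_upwards [this] with a ha
  exact hC (Set.mem_image_of_mem _ ha)

end FiniteMean

section StepOperator

variable {n : ℕ} {m : Type*} [Fintype m] {E : Type*} [NormedAddCommGroup E] [NormedSpace ℝ E]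

/-- The expectation of `g δ` over the random step size `δ`. -/
def sizeMean (z u : Fin n → ℝ) (g : ℝ → E) : E :=
  (plusProb z u).toReal • g (deltaPlus z u) + (1 - (plusProb z u).toReal) • g (-deltaMinus z u)

/-- The pivot is still active, so that the next round keeps it. -/
def PivotActive (s : State n) : Prop := ∃ p ∈ s.active, s.pivot = some p

open Classical in
/-- The probability that `p ∈ s.active` is the pivot of the next round. -/
def pivotWeight (s : State n) (p : Fin n) : ℝ :=
  if PivotActive s then (if s.pivot = some p then 1 else 0) else (s.active.card : ℝ)⁻¹

open Classical in
/-- The Markov operator of one round: the conditional expectation of `f` of the next state. -/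
def stepMean (B : Matrix m (Fin n) ℝ) (f : State n → E) (s : State n) : E :=
  if s.active.Nonempty then
    ∑ p ∈ s.active, pivotWeight s p • sizeMean s.z (stepDirection B s.active p)
      fun δ => f (updateState s p (stepDirection B s.active p) δ)
  else f s

theorem plusProb_toReal_nonneg (z u : Fin n → ℝ) : 0 ≤ (plusProb z u).toReal :=
  ENNReal.toReal_nonneg

theorem plusProb_toReal_le_one (z u : Fin n → ℝ) : (plusProb z u).toReal ≤ 1 :=
  ENNReal.toReal_le_of_le_ofReal zero_le_one (by simpa using plusProb_le_one z u)

theorem support_stepSizeLaw_finite (z u : Fin n → ℝ) : (stepSizeLaw z u).support.Finite :=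
  support_map_finite _ (Set.toFinite _)

theorem pmfMean_stepSizeLaw (z u : Fin n → ℝ) (g : ℝ → E) :
    pmfMean (stepSizeLaw z u) g = sizeMean z u g := by
  rw [stepSizeLaw, pmfMean_map _ (Set.toFinite _), pmfMean_eq_sum (S := Finset.univ) (by simp)]
  simp [sizeMean, ENNReal.toReal_sub_of_le (plusProb_le_one z u)]

theorem pmfMean_pivotLaw (s : State n) (h : s.active.Nonempty) (f : Fin n → E) :
    pmfMean (pivotLaw s h) f = ∑ p ∈ s.active, pivotWeight s p • f p := by
  classical
  by_cases hp : PivotActive s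
  · have hp' : ∃ p ∈ s.active, s.pivot = some p := hp
    rw [pivotLaw, dif_pos hp', pmfMean_pure]
    obtain ⟨h1, h2⟩ := hp'.choose_spec
    simp only [pivotWeight, if_pos hp]
    rw [Finset.sum_eq_single_of_mem _ h1]
    · rw [if_pos h2, one_smul]
    · intro b _ hb
      rw [if_neg, zero_smul]
      intro hb'
      rw [h2] at hb'
      exact hb (Option.some.inj hb').symm
  · have hp' : ¬ ∃ p ∈ s.active, s.pivot = some p := hp
    rw [pivotLaw, dif_neg hp', pmfMean_eq_sum (S := s.active)
      (fun a ha => PMF.uniformOfFinset_apply_of_notMem _ ha)]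
    refine Finset.sum_congr rfl fun p hpA => ?_
    simp only [pivotWeight, if_neg hp]
    rw [PMF.uniformOfFinset_apply_of_mem _ hpA]
    simp

theorem support_stepLaw_finite (B : Matrix m (Fin n) ℝ) (s : State n) :
    (stepLaw B s).support.Finite := by
  rw [stepLaw]
  split_ifs with h
  · exact support_bind_finite (Set.toFinite _)
      fun p _ => support_map_finite _ (support_stepSizeLaw_finite _ _)
  · rw [PMF.support_pure]; exact Set.finite_singleton _

theorem pmfMean_stepLaw (B : Matrix m (Fin n) ℝ) (s : State n) (f : State n → E) :
    pmfMean (stepLaw B s) f = stepMean B f s := by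
  rw [stepLaw, stepMean]
  split_ifs with h
  · rw [pmfMean_bind (Set.toFinite _)
      fun p _ => support_map_finite _ (support_stepSizeLaw_finite _ _), pmfMean_pivotLaw]
    refine Finset.sum_congr rfl fun p _ => ?_
    rw [pmfMean_map _ (support_stepSizeLaw_finite _ _), pmfMean_stepSizeLaw]
    rfl
  · exact pmfMean_pure _ _

theorem support_stateLaw_finite (B : Matrix m (Fin n) ℝ) (t : ℕ) :
    (stateLaw B t).support.Finite := by
  induction t with
  | zero => rw [stateLaw, PMF.support_pure]; exact Set.finite_singleton _
  | succ t ih => exact support_bind_finite ih fun s _ => support_stepLaw_finite B s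

theorem pmfMean_stateLaw (B : Matrix m (Fin n) ℝ) (t : ℕ) (f : State n → E) :
    pmfMean (stateLaw B t) f = (stepMean B)^[t] f (initState n) := by
  induction t generalizing f with
  | zero => exact pmfMean_pure _ _
  | succ t ih =>
    rw [stateLaw, pmfMean_bind (support_stateLaw_finite B t)
      fun s _ => support_stepLaw_finite B s, Function.iterate_succ_apply, ← ih]
    simp only [pmfMean_stepLaw]

/-- Expectations under the design law are iterates of the Markov operator. -/
theorem integral_designLaw {d : ℕ} [CompleteSpace E] (φ : ℝ) (X : Matrix (Fin n) (Fin d) ℝ)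
    {f : (Fin n → ℝ) → E} (hf : AEStronglyMeasurable f (designLaw φ X)) :
    ∫ z, f z ∂designLaw φ X
      = (stepMean (augMatrix φ X))^[n] (fun s => f s.z) (initState n) := by
  have h1 := support_stateLaw_finite (augMatrix φ X) n
  rw [designLaw] at hf ⊢
  rw [integral_toMeasure_eq_pmfMean (support_map_finite _ h1) hf, pmfMean_map _ h1,
    pmfMean_stateLaw]
  rfl

theorem sizeMean_add (z u : Fin n → ℝ) (f g : ℝ → E) :
    sizeMean z u (fun δ => f δ + g δ) = sizeMean z u f + sizeMean z u g := by
  simp only [sizeMean, smul_add]; abel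

theorem sizeMean_sub (z u : Fin n → ℝ) (f g : ℝ → E) :
    sizeMean z u (fun δ => f δ - g δ) = sizeMean z u f - sizeMean z u g := by
  simp only [sizeMean, smul_sub]; abel

theorem sizeMean_const (z u : Fin n → ℝ) (c : E) : sizeMean z u (fun _ => c) = c := by
  simp only [sizeMean, ← add_smul]; simp

theorem sizeMean_mul_left (z u : Fin n → ℝ) (c : ℝ) (f : ℝ → ℝ) :
    sizeMean z u (fun δ => c * f δ) = c * sizeMean z u f := by
  simp only [sizeMean, smul_eq_mul]; ring

theorem sizeMean_mono {z u : Fin n → ℝ} {f g : ℝ → ℝ}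
    (h1 : f (deltaPlus z u) ≤ g (deltaPlus z u))
    (h2 : f (-deltaMinus z u) ≤ g (-deltaMinus z u)) :
    sizeMean z u f ≤ sizeMean z u g :=
  add_le_add (mul_le_mul_of_nonneg_left h1 (plusProb_toReal_nonneg z u))
    (mul_le_mul_of_nonneg_left h2 (sub_nonneg.2 (plusProb_toReal_le_one z u)))

theorem norm_sizeMean_le (z u : Fin n → ℝ) (f : ℝ → E) :
    ‖sizeMean z u f‖ ≤ sizeMean z u fun δ => ‖f δ‖ := by
  refine (norm_add_le _ _).trans_eq ?_
  rw [norm_smul, norm_smul, Real.norm_of_nonneg (plusProb_toReal_nonneg z u),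
    Real.norm_of_nonneg (sub_nonneg.2 (plusProb_toReal_le_one z u))]
  rfl

theorem pivotWeight_nonneg (s : State n) (p : Fin n) : 0 ≤ pivotWeight s p := by
  unfold pivotWeight
  split_ifs <;> positivity

theorem sum_pivotWeight {s : State n} (h : s.active.Nonempty) :
    ∑ p ∈ s.active, pivotWeight s p = 1 := by
  classical
  by_cases hp : PivotActive s
  · simp only [pivotWeight, if_pos hp]
    obtain ⟨q, hq, hq'⟩ := hp
    rw [Finset.sum_eq_single_of_mem q hq]
    · simp [hq']
    · intro b _ hb
      rw [if_neg]
      rw [hq']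
      exact fun h => hb (Option.some.inj h).symm
  · simp only [pivotWeight, if_neg hp]
    have : (s.active.card : ℝ) ≠ 0 := by exact_mod_cast h.card_pos.ne'
    simp [this]

variable (B : Matrix m (Fin n) ℝ)

theorem stepMean_add (f g : State n → E) (s : State n) :
    stepMean B (fun s => f s + g s) s = stepMean B f s + stepMean B g s := by
  unfold stepMean
  split_ifs
  · simp only [sizeMean_add, smul_add, Finset.sum_add_distrib]
  · rfl

theorem stepMean_sub (f g : State n → E) (s : State n) :
    stepMean B (fun s => f s - g s) s = stepMean B f s - stepMean B g s := by
  unfold stepMean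
  split_ifs
  · simp only [sizeMean_sub, smul_sub, Finset.sum_sub_distrib]
  · rfl

theorem stepMean_const (c : E) (s : State n) : stepMean B (fun _ => c) s = c := by
  unfold stepMean
  split_ifs with h
  · simp only [sizeMean_const, ← Finset.sum_smul, sum_pivotWeight h, one_smul]
  · rfl

theorem stepMean_mul_left (c : ℝ) (f : State n → ℝ) (s : State n) :
    stepMean B (fun s => c * f s) s = c * stepMean B f s := by
  unfold stepMean
  split_ifs with h
  · rw [Finset.mul_sum]
    refine Finset.sum_congr rfl fun p _ => ?_
    rw [sizeMean_mul_left, smul_eq_mul, smul_eq_mul]; ring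
  · rfl

/-- The possible states after one round from `s`. -/
def IsNext (s s' : State n) : Prop :=
  (∃ p ∈ s.active, (PivotActive s → s.pivot = some p) ∧
    (s' = updateState s p (stepDirection B s.active p)
        (deltaPlus s.z (stepDirection B s.active p)) ∨
      s' = updateState s p (stepDirection B s.active p)
        (-deltaMinus s.z (stepDirection B s.active p)))) ∨
  (s.active = ∅ ∧ s' = s)

theorem stepMean_mono {f g : State n → ℝ} {s : State n} (h : ∀ s', IsNext B s s' → f s' ≤ g s') :
    stepMean B f s ≤ stepMean B g s := by
  classical
  unfold stepMean
  split_ifs with hs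
  · refine Finset.sum_le_sum fun p hp => ?_
    by_cases hpiv : PivotActive s → s.pivot = some p
    · refine mul_le_mul_of_nonneg_left (sizeMean_mono ?_ ?_) (pivotWeight_nonneg s p)
      · exact h _ (Or.inl ⟨p, hp, hpiv, Or.inl rfl⟩)
      · exact h _ (Or.inl ⟨p, hp, hpiv, Or.inr rfl⟩)
    · have : pivotWeight s p = 0 := by
        simp only [Classical.not_imp] at hpiv
        simp [pivotWeight, hpiv]
      simp [this]
  · exact h _ (Or.inr ⟨Finset.not_nonempty_iff_eq_empty.1 hs, rfl⟩)

theorem norm_stepMean_le (f : State n → E) (s : State n) :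
    ‖stepMean B f s‖ ≤ stepMean B (fun s => ‖f s‖) s := by
  unfold stepMean
  split_ifs with hs
  · refine (norm_sum_le _ _).trans (Finset.sum_le_sum fun p _ => ?_)
    rw [norm_smul, Real.norm_of_nonneg (pivotWeight_nonneg s p)]
    exact mul_le_mul_of_nonneg_left (norm_sizeMean_le _ _ _) (pivotWeight_nonneg s p)
  · exact le_rfl

theorem iterate_stepMean_sub (k : ℕ) (f g : State n → E) (s : State n) :
    (stepMean B)^[k] (fun s => f s - g s) s
      = (stepMean B)^[k] f s - (stepMean B)^[k] g s := by
  induction k generalizing s with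
  | zero => rfl
  | succ k ih =>
    simp only [Function.iterate_succ_apply']
    rw [← stepMean_sub]
    congr 1
    ext s'
    exact ih s'

theorem iterate_stepMean_const (k : ℕ) (c : E) (s : State n) :
    (stepMean B)^[k] (fun _ => c) s = c := by
  induction k generalizing s with
  | zero => rfl
  | succ k ih =>
    rw [Function.iterate_succ_apply', funext ih, stepMean_const]

theorem iterate_stepMean_mono (k : ℕ) {f g : State n → ℝ} (h : ∀ s, f s ≤ g s) (s : State n) :
    (stepMean B)^[k] f s ≤ (stepMean B)^[k] g s := by
  induction k generalizing s with
  | zero => exact h s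
  | succ k ih =>
    simp only [Function.iterate_succ_apply']
    exact stepMean_mono B fun s' _ => ih s'

theorem norm_iterate_stepMean_le (k : ℕ) (f : State n → E) (s : State n) :
    ‖(stepMean B)^[k] f s‖ ≤ (stepMean B)^[k] (fun s => ‖f s‖) s := by
  induction k generalizing s with
  | zero => exact le_rfl
  | succ k ih =>
    simp only [Function.iterate_succ_apply']
    exact (norm_stepMean_le B _ s).trans (stepMean_mono B fun s' _ => ih s')

end StepOperator

/-! ### Step sizes and the variance bound from an arbitrary state -/

section StepSize

variable {n : ℕ} {z u : Fin n → ℝ} {p : Fin n}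

theorem stepSet_isClosed (z u : Fin n → ℝ) : IsClosed (stepSet z u) := by
  have : stepSet z u = ⋂ i, (fun δ : ℝ => z i + δ * u i) ⁻¹' Set.Icc (-1 : ℝ) 1 := by
    ext δ; simp [stepSet]
  rw [this]
  exact isClosed_iInter fun i => isClosed_Icc.preimage (by fun_prop)

theorem zero_mem_stepSet (hz : ∀ i, |z i| ≤ 1) : (0 : ℝ) ∈ stepSet z u := fun i => by
  simpa using abs_le.1 (hz i)

theorem stepSet_subset (hz : ∀ i, |z i| ≤ 1) (hp : u p = 1) :
    stepSet z u ⊆ Set.Icc (-2) 2 := by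
  intro δ hδ
  have h1 := hδ p
  have h2 := abs_le.1 (hz p)
  rw [hp, mul_one] at h1
  exact ⟨by linarith [h1.1], by linarith [h1.2]⟩

theorem deltaPlus_mem (hz : ∀ i, |z i| ≤ 1) (hp : u p = 1) : deltaPlus z u ∈ stepSet z u := by
  have hb : BddAbove (stepSet z u) := bddAbove_Icc.mono (stepSet_subset hz hp)
  rw [deltaPlus, abs_of_nonneg (le_csSup hb (zero_mem_stepSet hz))]
  exact (stepSet_isClosed z u).csSup_mem ⟨0, zero_mem_stepSet hz⟩ hb

theorem neg_deltaMinus_mem (hz : ∀ i, |z i| ≤ 1) (hp : u p = 1) :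
    -deltaMinus z u ∈ stepSet z u := by
  have hb : BddBelow (stepSet z u) := bddBelow_Icc.mono (stepSet_subset hz hp)
  rw [deltaMinus, abs_of_nonpos (csInf_le hb (zero_mem_stepSet hz)), neg_neg]
  exact (stepSet_isClosed z u).csInf_mem ⟨0, zero_mem_stepSet hz⟩ hb

theorem plusProb_toReal (z u : Fin n → ℝ) :
    (plusProb z u).toReal = deltaMinus z u / (deltaPlus z u + deltaMinus z u) :=
  ENNReal.toReal_ofReal (div_nonneg (abs_nonneg _) (add_nonneg (abs_nonneg _) (abs_nonneg _)))

/-- The step size is centred. -/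
theorem sizeMean_id (z u : Fin n → ℝ) : sizeMean z u (fun δ => δ) = 0 := by
  have h1 : 0 ≤ deltaPlus z u := abs_nonneg _
  have h2 : 0 ≤ deltaMinus z u := abs_nonneg _
  simp only [sizeMean, plusProb_toReal, smul_eq_mul]
  rcases (add_nonneg h1 h2).eq_or_lt with h | h
  -- if both step sizes vanish, the quotient defining the probability is `0 / 0`, and nothing moves
  · have h3 : deltaPlus z u = 0 := by linarith
    have h4 : deltaMinus z u = 0 := by linarith
    simp [h3, h4]
  · field_simp
    ring

theorem sizeMean_quadratic (z u : Fin n → ℝ) (a b c : ℝ) :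
    sizeMean z u (fun δ => a + b * δ + c * δ ^ 2) = a + c * sizeMean z u fun δ => δ ^ 2 := by
  rw [sizeMean_add, sizeMean_add, sizeMean_const, sizeMean_mul_left, sizeMean_mul_left,
    sizeMean_id]
  ring

theorem sizeMean_nonneg {f : ℝ → ℝ} (h : ∀ δ, 0 ≤ f δ) : 0 ≤ sizeMean z u f := by
  rw [← sizeMean_const z u (0 : ℝ)]
  exact sizeMean_mono (h _) (h _)

end StepSize

section VarianceBound

variable {n d : ℕ} {m : Type*} [Fintype m] {B : Matrix m (Fin n) ℝ}
  {Y : Matrix (Fin n) (Fin d) ℝ} {v : Fin n → ℝ}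

theorem stepMean_le_of_forall_pivot {f : State n → ℝ} {s : State n} {a : ℝ}
    (h : ∀ p ∈ s.active, (PivotActive s → s.pivot = some p) →
      sizeMean s.z (stepDirection B s.active p)
        (fun δ => f (updateState s p (stepDirection B s.active p) δ)) ≤ a)
    (h0 : f s ≤ a) : stepMean B f s ≤ a := by
  classical
  unfold stepMean
  split_ifs with hs
  · rw [← one_mul a, ← sum_pivotWeight hs, Finset.sum_mul]
    refine Finset.sum_le_sum fun p hp => ?_
    by_cases hpiv : PivotActive s → s.pivot = some p
    · exact mul_le_mul_of_nonneg_left (h p hp hpiv) (pivotWeight_nonneg s p)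
    · have : pivotWeight s p = 0 := by
        simp only [Classical.not_imp] at hpiv
        simp [pivotWeight, hpiv]
      simp [this]
  · exact h0

/-- The assignment lies in the cube `[-1, 1]^n`. -/
def InCube (s : State n) : Prop := ∀ i, |s.z i| ≤ 1

theorem inCube_updateState {s : State n} {p : Fin n} {u : Fin n → ℝ} {δ : ℝ}
    (h : δ ∈ stepSet s.z u) : InCube (updateState s p u δ) := fun i => by
  simpa [updateState] using abs_le.2 (h i)

/-- An upper bound, up to a constant factor, for the variance of `⟨z, v⟩` that the walk still
generates from the state `s`. The formula covers an inactive pivot `p` as well, since then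
`s.active.erase p = s.active`. -/
def varPotential (Y : Matrix (Fin n) (Fin d) ℝ) (v : Fin n → ℝ) (s : State n) : ℝ :=
  s.pivot.elim (residualVar Y v s.active) fun p =>
    s.z p ^ 2 * residualVar Y v (s.active.erase p)
      + (1 - s.z p ^ 2) * residualVar Y v s.active

theorem varPotential_nonneg {s : State n} (hs : InCube s) : 0 ≤ varPotential Y v s := by
  unfold varPotential
  cases s.pivot with
  | none => exact residualVar_nonneg Y v _
  | some p =>
    have h1 : s.z p ^ 2 ≤ 1 := (sq_le_one_iff_abs_le_one _).2 (hs p)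
    exact add_nonneg (mul_nonneg (sq_nonneg _) (residualVar_nonneg Y v _))
      (mul_nonneg (by linarith) (residualVar_nonneg Y v _))

theorem varPotential_of_not_pivotActive {s : State n} (h : ¬ PivotActive s) :
    varPotential Y v s = residualVar Y v s.active := by
  unfold varPotential
  cases hp : s.pivot with
  | none => rfl
  | some p =>
    have : p ∉ s.active := fun hpA => h ⟨p, hpA, hp⟩
    simp only [Option.elim_some, Finset.erase_eq_of_notMem this]
    ring

theorem active_updateState_subset (s : State n) (p : Fin n) (u : Fin n → ℝ) (δ : ℝ) :
    (updateState s p u δ).active ⊆ s.active := Finset.filter_subset _ _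

variable {c C : ℝ}

/-- The potential dominates the variance generated in one round. -/
theorem stepMean_sq_add_varPotential_le (hc : 0 < c)
    (hB : ∀ w, euclNorm (B *ᵥ w) ^ 2 = c * covForm Y w w) (hY : ∀ i, 1 + Y i ⬝ᵥ Y i ≤ C)
    (a : ℝ) {s : State n} (hs : InCube s) :
    stepMean B (fun s => (s.z ⬝ᵥ v - a) ^ 2 + C * varPotential Y v s) s
      ≤ (s.z ⬝ᵥ v - a) ^ 2 + C * varPotential Y v s := by
  refine stepMean_le_of_forall_pivot (fun p hp hpiv => ?_) le_rfl
  have hC : 0 ≤ C := le_trans (add_nonneg zero_le_one (dotProduct_self_nonneg_real (Y p))) (hY p)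
  set u := stepDirection B s.active p with hu
  have hdir : IsPivotDirection Y s.active p u := isPivotDirection_stepDirection hc hB hp
  set R := residualVar Y v s.active with hR
  set R' := residualVar Y v (s.active.erase p) with hR'
  have hRR : R' ≤ R := residualVar_mono Y v (Finset.erase_subset _ _)
  have hq : covForm Y u u ≤ C := by
    have hr0 : 0 ≤ Y p ⬝ᵥ Y p := dotProduct_self_nonneg_real _
    have := hdir.covForm_self_le (r := √(Y p ⬝ᵥ Y p)) hp (by rw [Real.sq_sqrt hr0])
    rw [Real.sq_sqrt hr0] at this
    exact this.trans (hY p)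
  have hsq : (v ⬝ᵥ u) ^ 2 ≤ C * (R - R') := by
    rw [hdir.residualVar_erase hp v]
    exact mul_le_mul_of_nonneg_right hq (by linarith)
  have hz1 : s.z p ^ 2 ≤ 1 := (sq_le_one_iff_abs_le_one _).2 (hs p)
  have hpot : s.z p ^ 2 * R' + (1 - s.z p ^ 2) * R ≤ varPotential Y v s := by
    by_cases hact : PivotActive s
    · rw [varPotential, hpiv hact]; rfl
    · rw [varPotential_of_not_pivotActive hact]
      nlinarith [sq_nonneg (s.z p)]
  have hpt : ∀ δ ∈ stepSet s.z u,
      ((updateState s p u δ).z ⬝ᵥ v - a) ^ 2 + C * varPotential Y v (updateState s p u δ)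
        ≤ ((s.z ⬝ᵥ v - a) ^ 2 + C * (s.z p ^ 2 * R' + (1 - s.z p ^ 2) * R))
          + (2 * (s.z ⬝ᵥ v - a) * (v ⬝ᵥ u) - 2 * C * s.z p * (R - R')) * δ
          + ((v ⬝ᵥ u) ^ 2 - C * (R - R')) * δ ^ 2 := by
    intro δ hδ
    have hsub := active_updateState_subset s p u δ
    have h1 : (updateState s p u δ).z p = s.z p + δ := by simp [updateState, hdir.2.1]
    have h2 : (updateState s p u δ).z ⬝ᵥ v = s.z ⬝ᵥ v + δ * (v ⬝ᵥ u) := by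
      simp [updateState, add_dotProduct, smul_dotProduct, dotProduct_comm u v]
    have h3 : (s.z p + δ) ^ 2 ≤ 1 := by
      rw [← h1]; exact (sq_le_one_iff_abs_le_one _).2 (inCube_updateState hδ p)
    have h4 : varPotential Y v (updateState s p u δ)
        ≤ (s.z p + δ) ^ 2 * R' + (1 - (s.z p + δ) ^ 2) * R := by
      have hpv : (updateState s p u δ).pivot = some p := rfl
      rw [varPotential, hpv]
      simp only [Option.elim_some, h1]
      exact add_le_add
        (mul_le_mul_of_nonneg_left (residualVar_mono Y v (Finset.erase_subset_erase _ hsub))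
          (sq_nonneg _))
        (mul_le_mul_of_nonneg_left (residualVar_mono Y v hsub) (by linarith))
    rw [h2]
    nlinarith [mul_le_mul_of_nonneg_left h4 hC]
  refine (sizeMean_mono (g := fun δ =>
      ((s.z ⬝ᵥ v - a) ^ 2 + C * (s.z p ^ 2 * R' + (1 - s.z p ^ 2) * R))
          + (2 * (s.z ⬝ᵥ v - a) * (v ⬝ᵥ u) - 2 * C * s.z p * (R - R')) * δ
          + ((v ⬝ᵥ u) ^ 2 - C * (R - R')) * δ ^ 2) (hpt _ (deltaPlus_mem hs hdir.2.1))
    (hpt _ (neg_deltaMinus_mem hs hdir.2.1))).trans ?_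
  rw [sizeMean_quadratic]
  have h5 : 0 ≤ sizeMean s.z u fun δ => δ ^ 2 := sizeMean_nonneg fun δ => sq_nonneg δ
  nlinarith [mul_le_mul_of_nonneg_left hpot hC]

theorem inCube_of_isNext (hc : 0 < c)
    (hB : ∀ w, euclNorm (B *ᵥ w) ^ 2 = c * covForm Y w w) {s s' : State n} (hs : InCube s)
    (h : IsNext B s s') : InCube s' := by
  rcases h with ⟨p, hp, -, h | h⟩ | ⟨-, h⟩
  · rw [h]
    exact inCube_updateState (deltaPlus_mem hs (isPivotDirection_stepDirection hc hB hp).2.1)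
  · rw [h]
    exact inCube_updateState (neg_deltaMinus_mem hs (isPivotDirection_stepDirection hc hB hp).2.1)
  · rwa [h]

/-- The variance bound for the walk started at an arbitrary state of the cube. -/
theorem iterate_stepMean_sq_le (hc : 0 < c)
    (hB : ∀ w, euclNorm (B *ᵥ w) ^ 2 = c * covForm Y w w) (hY : ∀ i, 1 + Y i ⬝ᵥ Y i ≤ C)
    (hC : 0 ≤ C) (a : ℝ) (k : ℕ) {s : State n} (hs : InCube s) :
    (stepMean B)^[k] (fun s => (s.z ⬝ᵥ v - a) ^ 2) s
      ≤ (s.z ⬝ᵥ v - a) ^ 2 + C * varPotential Y v s := by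
  induction k generalizing s with
  | zero => exact le_add_of_nonneg_right (mul_nonneg hC (varPotential_nonneg hs))
  | succ k ih =>
    rw [Function.iterate_succ_apply']
    exact (stepMean_mono B fun s' hs' => ih (inCube_of_isNext hc hB hs hs')).trans
      (stepMean_sq_add_varPotential_le hc hB hY a hs)

theorem stepMean_dotProduct (s : State n) (v : Fin n → ℝ) :
    stepMean B (fun s => s.z ⬝ᵥ v) s = s.z ⬝ᵥ v := by
  unfold stepMean
  split_ifs with hs
  · have : ∀ p ∈ s.active, pivotWeight s p • sizeMean s.z (stepDirection B s.active p)
        (fun δ => (updateState s p (stepDirection B s.active p) δ).z ⬝ᵥ v)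
          = pivotWeight s p * (s.z ⬝ᵥ v) := by
      intro p _
      have h := sizeMean_quadratic s.z (stepDirection B s.active p) (s.z ⬝ᵥ v)
        (stepDirection B s.active p ⬝ᵥ v) 0
      simp only [zero_mul, add_zero] at h
      rw [smul_eq_mul, ← h]
      simp only [updateState, add_dotProduct, smul_dotProduct, smul_eq_mul, mul_comm]
    rw [Finset.sum_congr rfl this, ← Finset.sum_mul, sum_pivotWeight hs, one_mul]
  · rfl

theorem iterate_stepMean_dotProduct (k : ℕ) (s : State n) (v : Fin n → ℝ) :
    (stepMean B)^[k] (fun s => s.z ⬝ᵥ v) s = s.z ⬝ᵥ v := by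
  induction k generalizing s with
  | zero => rfl
  | succ k ih => rw [Function.iterate_succ_apply', funext ih, stepMean_dotProduct]

/-- Squares of martingales are submartingales. -/
theorem le_iterate_stepMean_sq (k : ℕ) (s : State n) :
    (s.z ⬝ᵥ v) ^ 2 ≤ (stepMean B)^[k] (fun s => (s.z ⬝ᵥ v) ^ 2) s := by
  set a := s.z ⬝ᵥ v with ha
  have h1 : (stepMean B)^[k] (fun s => 2 * a * (s.z ⬝ᵥ v) - a ^ 2) s
      ≤ (stepMean B)^[k] (fun s => (s.z ⬝ᵥ v) ^ 2) s :=
    iterate_stepMean_mono B k (fun s => by nlinarith [sq_nonneg (s.z ⬝ᵥ v - a)]) s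
  have h2 := iterate_stepMean_dotProduct (B := B) k s ((2 * a) • v)
  rw [iterate_stepMean_sub, iterate_stepMean_const] at h1
  simp only [dotProduct_smul, smul_eq_mul] at h2
  rw [h2, ← ha] at h1
  nlinarith

end VarianceBound

section FreeStep

variable {n : ℕ} {z u : Fin n → ℝ} {p : Fin n}

/-- If no other coordinate can reach the boundary of the cube, the step sizes are those that bring
the pivot to `±1`. -/
theorem stepSet_eq_Icc (hp : u p = 1)
    (hj : ∀ j, j ≠ p → |z j| + 2 * |u j| ≤ 1) (hzp : |z p| ≤ 1) :
    stepSet z u = Set.Icc (-1 - z p) (1 - z p) := by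
  ext δ
  constructor
  · intro h
    have := h p
    rw [hp, mul_one] at this
    exact ⟨by linarith [this.1], by linarith [this.2]⟩
  · intro h i
    by_cases hi : i = p
    · subst hi
      rw [hp, mul_one]
      exact ⟨by linarith [h.1], by linarith [h.2]⟩
    · have h1 := abs_le.1 hzp
      have h2 : |δ| ≤ 2 := abs_le.2 ⟨by linarith [h.1], by linarith [h.2]⟩
      have h3 : |z i + δ * u i| ≤ 1 := by
        refine (abs_add_le _ _).trans (le_trans ?_ (hj i hi))
        rw [abs_mul]
        gcongr
      exact abs_le.1 h3

theorem deltaPlus_eq (hp : u p = 1)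
    (hj : ∀ j, j ≠ p → |z j| + 2 * |u j| ≤ 1) (hzp : |z p| ≤ 1) :
    deltaPlus z u = 1 - z p := by
  have h1 := abs_le.1 hzp
  rw [deltaPlus, stepSet_eq_Icc hp hj hzp, csSup_Icc (by linarith), abs_of_nonneg (by linarith)]

theorem deltaMinus_eq (hp : u p = 1)
    (hj : ∀ j, j ≠ p → |z j| + 2 * |u j| ≤ 1) (hzp : |z p| ≤ 1) :
    deltaMinus z u = 1 + z p := by
  have h1 := abs_le.1 hzp
  rw [deltaMinus, stepSet_eq_Icc hp hj hzp, csInf_Icc (by linarith), abs_of_nonpos (by linarith)]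
  ring

theorem sizeMean_sq (hp : u p = 1)
    (hj : ∀ j, j ≠ p → |z j| + 2 * |u j| ≤ 1) (hzp : |z p| ≤ 1) :
    sizeMean z u (fun δ => δ ^ 2) = 1 - z p ^ 2 := by
  simp only [sizeMean, plusProb_toReal, deltaPlus_eq hp hj hzp, deltaMinus_eq hp hj hzp,
    smul_eq_mul]
  ring

end FreeStep

/-! ### Free steps and the potentials that control bad states -/

section RegularStates

variable {n d : ℕ} {m : Type*} [Fintype m] {B : Matrix m (Fin n) ℝ}
  {E : Type*} [NormedAddCommGroup E] [NormedSpace ℝ E]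

/-- The assignment lies in the cube and the next pivot will be drawn afresh. -/
def IsRegular (s : State n) : Prop := ¬ PivotActive s ∧ InCube s

/-- A regular state from which every possible step freezes the pivot and nothing else: active
coordinates are at most `η`, and each step moves the other coordinates at speed at most `β`. -/
structure IsFree (B : Matrix m (Fin n) ℝ) (η β : ℝ) (s : State n) : Prop where
  regular : IsRegular s
  nonempty : s.active.Nonempty
  abs_z_le : ∀ j ∈ s.active, |s.z j| ≤ η
  pivot_eq : ∀ p ∈ s.active, stepDirection B s.active p p = 1
  supp : ∀ p ∈ s.active, ∀ i, i ∉ s.active → stepDirection B s.active p i = 0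
  speed : ∀ p ∈ s.active, ∀ j, j ≠ p → |stepDirection B s.active p j| ≤ β
  margin : η + 2 * β < 1

variable {η β : ℝ} {s : State n} {p : Fin n}

theorem IsFree.clearance (h : IsFree B η β s) (hp : p ∈ s.active) (j : Fin n) (hj : j ≠ p) :
    |s.z j| + 2 * |stepDirection B s.active p j| ≤ 1 := by
  by_cases hjA : j ∈ s.active
  · linarith [h.abs_z_le j hjA, h.speed p hp j hj, h.margin]
  · rw [h.supp p hp j hjA]
    simpa using h.regular.2 j

/-- The state after a free step. -/
def freeNext (B : Matrix m (Fin n) ℝ) (s : State n) (p : Fin n) (δ : ℝ) : State n :=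
  ⟨s.z + δ • stepDirection B s.active p, s.active.erase p, some p⟩

theorem IsFree.updateState_eq (h : IsFree B η β s) (hp : p ∈ s.active) {δ : ℝ} (hδ2 : |δ| ≤ 2)
    (hδ : |s.z p + δ| = 1) :
    updateState s p (stepDirection B s.active p) δ = freeNext B s p δ := by
  simp only [updateState, freeNext, State.mk.injEq, and_true, true_and]
  ext j
  simp only [Finset.mem_filter, Finset.mem_erase, Pi.add_apply, Pi.smul_apply, smul_eq_mul]
  by_cases hj : j = p
  · subst hj
    simp [h.pivot_eq j hp, hδ]
  · have : j ∈ s.active → |s.z j + δ * stepDirection B s.active p j| < 1 := by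
      intro hjA
      refine (abs_add_le _ _).trans_lt (lt_of_le_of_lt ?_ h.margin)
      rw [abs_mul]
      exact add_le_add (h.abs_z_le j hjA)
        (mul_le_mul hδ2 (h.speed p hp j hj) (abs_nonneg _) (by norm_num))
    tauto

theorem IsFree.deltaPlus_eq (h : IsFree B η β s) (hp : p ∈ s.active) :
    deltaPlus s.z (stepDirection B s.active p) = 1 - s.z p :=
  GSW.deltaPlus_eq (h.pivot_eq p hp) (h.clearance hp) (h.regular.2 p)

theorem IsFree.deltaMinus_eq (h : IsFree B η β s) (hp : p ∈ s.active) :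
    deltaMinus s.z (stepDirection B s.active p) = 1 + s.z p :=
  GSW.deltaMinus_eq (h.pivot_eq p hp) (h.clearance hp) (h.regular.2 p)

theorem IsFree.sizeMean_sq (h : IsFree B η β s) (hp : p ∈ s.active) :
    sizeMean s.z (stepDirection B s.active p) (fun δ => δ ^ 2) = 1 - s.z p ^ 2 :=
  GSW.sizeMean_sq (h.pivot_eq p hp) (h.clearance hp) (h.regular.2 p)

theorem IsFree.sizeMean_le (h : IsFree B η β s) (hp : p ∈ s.active) {f g : ℝ → ℝ}
    (hfg : ∀ δ, |δ| ≤ 2 → |s.z p + δ| = 1 → f δ ≤ g δ) :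
    sizeMean s.z (stepDirection B s.active p) f ≤ sizeMean s.z (stepDirection B s.active p) g := by
  have h1 := abs_le.1 (h.regular.2 p)
  refine sizeMean_mono ?_ ?_
  · rw [h.deltaPlus_eq hp]
    exact hfg _ (abs_le.2 ⟨by linarith, by linarith⟩) (by simp)
  · rw [h.deltaMinus_eq hp]
    exact hfg _ (abs_le.2 ⟨by linarith, by linarith⟩) (by simp)

/-- The Markov operator at a free state: the pivot is a uniformly random active coordinate, which
moves to `±1` and is the only one removed. -/
theorem IsFree.stepMean_eq (h : IsFree B η β s) (f : State n → E) :
    stepMean B f s = (s.active.card : ℝ)⁻¹ • ∑ p ∈ s.active,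
      sizeMean s.z (stepDirection B s.active p) fun δ => f (freeNext B s p δ) := by
  have h0 := h.regular.1
  rw [stepMean, if_pos h.nonempty, Finset.smul_sum]
  refine Finset.sum_congr rfl fun p hp => ?_
  have h1 := abs_le.1 (h.regular.2 p)
  rw [pivotWeight, if_neg h0]
  congr 1
  simp only [sizeMean, h.deltaPlus_eq hp, h.deltaMinus_eq hp]
  rw [h.updateState_eq hp (abs_le.2 ⟨by linarith, by linarith⟩) (by simp),
    h.updateState_eq hp (abs_le.2 ⟨by linarith, by linarith⟩) (by simp)]

theorem IsFree.isRegular_freeNext (h : IsFree B η β s) (hp : p ∈ s.active) {δ : ℝ}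
    (hδ2 : |δ| ≤ 2) (hδ : |s.z p + δ| = 1) : IsRegular (freeNext B s p δ) := by
  refine ⟨?_, fun j => ?_⟩
  · rintro ⟨q, hq, hq'⟩
    have : p = q := Option.some.inj hq'
    simp [freeNext, this] at hq
  · by_cases hj : j = p
    · subst hj
      simp [freeNext, h.pivot_eq j hp, hδ]
    · refine le_trans ?_ (h.clearance hp j hj)
      simp only [freeNext, Pi.add_apply, Pi.smul_apply, smul_eq_mul]
      refine (abs_add_le _ _).trans ?_
      rw [abs_mul]
      gcongr

theorem IsFree.stepMean_le (h : IsFree B η β s) {f g : State n → ℝ}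
    (hfg : ∀ s', IsRegular s' → s'.active.card + 1 = s.active.card → f s' ≤ g s') :
    stepMean B f s ≤ stepMean B g s := by
  rw [h.stepMean_eq, h.stepMean_eq]
  refine mul_le_mul_of_nonneg_left (Finset.sum_le_sum fun p hp => h.sizeMean_le hp ?_)
    (by positivity)
  intro δ h2 h1
  exact hfg _ (h.isRegular_freeNext hp h2 h1) (Finset.card_erase_add_one hp)

theorem IsFree.stepMean_active (h : IsFree B η β s) (F : Finset (Fin n) → ℝ) :
    stepMean B (fun s => F s.active) s
      = (s.active.card : ℝ)⁻¹ * ∑ p ∈ s.active, F (s.active.erase p) := by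
  rw [h.stepMean_eq, smul_eq_mul]
  simp only [freeNext, sizeMean_const]

theorem IsFree.sizeMean_le_of_quadratic (h : IsFree B η β s) (hp : p ∈ s.active) {f : ℝ → ℝ}
    {a b c : ℝ} (hc : 0 ≤ c) (hf : ∀ δ, |δ| ≤ 2 → f δ ≤ a + b * δ + c * δ ^ 2) :
    sizeMean s.z (stepDirection B s.active p) f ≤ a + c := by
  refine (h.sizeMean_le hp (g := fun δ => a + b * δ + c * δ ^ 2) fun δ h2 _ => hf δ h2).trans ?_
  rw [sizeMean_quadratic, h.sizeMean_sq hp]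
  nlinarith [sq_nonneg (s.z p)]

end RegularStates

section Potentials

variable {n d : ℕ} {m : Type*} [Fintype m] {B : Matrix m (Fin n) ℝ}
  {η β : ℝ} {s : State n}

/-- Fourth-moment potential that controls the drift of the active coordinates away from `0`: a
coordinate with `k` rounds to go contributes `(z² + 5 k β²)²`. -/
def driftPotential (β : ℝ) (s : State n) : ℝ :=
  ∑ j ∈ s.active, (s.z j ^ 2 + 5 * s.active.card * β ^ 2) ^ 2

/-- One round adds at most `10 x β² + 8 β⁴` to the expected square of `x = z² + 5 (k - 1) β²`, and this
is less than `(x + 5 β²)² - x²`. -/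
theorem IsFree.stepMean_driftPotential_le (h : IsFree B η β s) :
    stepMean B (driftPotential β) s ≤ driftPotential β s := by
  have hk : (0 : ℝ) < s.active.card := by exact_mod_cast h.nonempty.card_pos
  have key : ∀ p ∈ s.active, sizeMean s.z (stepDirection B s.active p)
      (fun δ => driftPotential β (freeNext B s p δ)) ≤ driftPotential β s := by
    intro p hp
    set u := stepDirection B s.active p with hu
    have hcard : (((s.active.erase p).card : ℕ) : ℝ) = s.active.card - 1 := by
      rw [Finset.card_erase_of_mem hp, Nat.cast_pred h.nonempty.card_pos]
    have hk1 : (0 : ℝ) ≤ (s.active.card : ℝ) - 1 := by rw [← hcard]; positivity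
    set x : Fin n → ℝ := fun j => s.z j ^ 2 + 5 * ((s.active.card : ℝ) - 1) * β ^ 2 with hx
    have hx0 : ∀ j, s.z j ^ 2 ≤ x j := fun j => by
      simp only [hx]; linarith [mul_nonneg hk1 (sq_nonneg β)]
    have hpt : ∀ δ, |δ| ≤ 2 → driftPotential β (freeNext B s p δ)
        ≤ ∑ j ∈ s.active.erase p, x j ^ 2 + (∑ j ∈ s.active.erase p, 4 * x j * s.z j * u j) * δ
          + (∑ j ∈ s.active.erase p,
              (2 * x j * u j ^ 2 + 8 * s.z j ^ 2 * u j ^ 2 + 8 * u j ^ 4)) * δ ^ 2 := by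
      intro δ hδ
      rw [Finset.sum_mul, Finset.sum_mul, ← Finset.sum_add_distrib, ← Finset.sum_add_distrib]
      simp only [driftPotential, freeNext, Pi.add_apply, Pi.smul_apply, smul_eq_mul, hcard]
      refine Finset.sum_le_sum fun j _ => ?_
      have hδ' := abs_le.1 hδ
      have e1 : (s.z j + δ * u j) ^ 2 + 5 * ((s.active.card : ℝ) - 1) * β ^ 2
          = x j + 2 * s.z j * u j * δ + u j ^ 2 * δ ^ 2 := by simp only [hx]; ring
      rw [e1]
      have e2 : 4 * (s.z j * u j ^ 3) * δ ^ 3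
          ≤ 4 * (s.z j ^ 2 * u j ^ 2 + u j ^ 4) * δ ^ 2 := by
        have h3 : s.z j * u j ^ 3 * δ ≤ s.z j ^ 2 * u j ^ 2 + u j ^ 4 := by
          nlinarith [sq_nonneg (s.z j * u j - u j ^ 2 * δ / 2), sq_nonneg (u j ^ 2),
            mul_nonneg (sq_nonneg (u j ^ 2)) (by nlinarith : (0 : ℝ) ≤ 4 - δ ^ 2)]
        nlinarith [mul_le_mul_of_nonneg_right h3 (sq_nonneg δ)]
      have e3 : u j ^ 4 * δ ^ 4 ≤ 4 * u j ^ 4 * δ ^ 2 := by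
        have h4 : δ ^ 2 ≤ 4 := by nlinarith
        have : 0 ≤ u j ^ 4 * δ ^ 2 := by positivity
        nlinarith
      nlinarith
    refine (h.sizeMean_le_of_quadratic hp (Finset.sum_nonneg fun j _ => ?_) hpt).trans ?_
    · have := (sq_nonneg _).trans (hx0 j)
      positivity
    · rw [← Finset.sum_add_distrib]
      refine (Finset.sum_le_sum (g := fun j =>
        (s.z j ^ 2 + 5 * s.active.card * β ^ 2) ^ 2) fun j hj => ?_).trans
        (Finset.sum_le_sum_of_subset_of_nonneg (Finset.erase_subset _ _)
          fun _ _ _ => sq_nonneg _)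
      have huj : u j ^ 2 ≤ β ^ 2 := by
        have := h.speed p hp j (Finset.ne_of_mem_erase hj)
        rw [← sq_abs]
        exact pow_le_pow_left₀ (abs_nonneg _) this 2
      have e : s.z j ^ 2 + 5 * s.active.card * β ^ 2 = x j + 5 * β ^ 2 := by
        simp only [hx]; ring
      rw [e]
      have h5 := hx0 j
      have h6 : 0 ≤ s.z j ^ 2 := sq_nonneg _
      have h7 : 0 ≤ u j ^ 2 := sq_nonneg _
      have h8 : x j * u j ^ 2 ≤ x j * β ^ 2 := mul_le_mul_of_nonneg_left huj (h6.trans h5)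
      have h9 : s.z j ^ 2 * u j ^ 2 ≤ x j * β ^ 2 := mul_le_mul h5 huj h7 (h6.trans h5)
      have h10 : u j ^ 4 ≤ β ^ 4 := by nlinarith
      nlinarith [sq_nonneg (β ^ 2)]
  rw [h.stepMean_eq, smul_eq_mul]
  refine (mul_le_mul_of_nonneg_left (Finset.sum_le_sum key) (by positivity)).trans_eq ?_
  rw [Finset.sum_const, nsmul_eq_mul]
  field_simp

theorem driftPotential_nonneg (β : ℝ) (s : State n) : 0 ≤ driftPotential β s :=
  Finset.sum_nonneg fun _ _ => sq_nonneg _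

theorem pow_le_driftPotential (hη : 0 ≤ η) {j : Fin n} (hj : j ∈ s.active) (hz : η ≤ |s.z j|) :
    η ^ 4 ≤ driftPotential β s := by
  refine le_trans ?_ (Finset.single_le_sum
    (f := fun j => (s.z j ^ 2 + 5 * s.active.card * β ^ 2) ^ 2) (fun _ _ => sq_nonneg _) hj)
  have h1 : η ^ 2 ≤ s.z j ^ 2 := by
    rw [← sq_abs (s.z j)]
    exact pow_le_pow_left₀ hη hz 2
  have h2 : η ^ 2 ≤ s.z j ^ 2 + 5 * s.active.card * β ^ 2 :=
    h1.trans (le_add_of_nonneg_right (by positivity))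
  calc η ^ 4 = (η ^ 2) ^ 2 := by ring
    _ ≤ _ := pow_le_pow_left₀ (sq_nonneg _) h2 2

/-- The squared Frobenius distance between the second-moment matrices of the active rows of `Y`
and of all rows. -/
def covDeviation (Y : Matrix (Fin n) (Fin d) ℝ) (A : Finset (Fin n)) : ℝ :=
  ∑ a, ∑ b, ((∑ i ∈ A, Y i a * Y i b) / A.card - (∑ i, Y i a * Y i b) / n) ^ 2

theorem covDeviation_nonneg (Y : Matrix (Fin n) (Fin d) ℝ) (A : Finset (Fin n)) :
    0 ≤ covDeviation Y A :=
  Finset.sum_nonneg fun _ _ => Finset.sum_nonneg fun _ _ => sq_nonneg _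

theorem covDeviation_univ (Y : Matrix (Fin n) (Fin d) ℝ) : covDeviation Y Finset.univ = 0 := by
  simp [covDeviation]

/-- The mean of a sample is a martingale when a random element of the sample is discarded. -/
theorem sum_sq_mean_erase_le {ι : Type*} [DecidableEq ι] (A : Finset ι) (hA : 2 ≤ A.card)
    (f : ι → ℝ) (c : ℝ) :
    ∑ p ∈ A, ((∑ i ∈ A.erase p, f i) / (A.erase p).card - c) ^ 2
      ≤ A.card * ((∑ i ∈ A, f i) / A.card - c) ^ 2 + (∑ p ∈ A, f p ^ 2) / (A.card - 1) ^ 2 := by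
  set k : ℝ := (A.card : ℝ) with hk
  set S := ∑ i ∈ A, f i with hS
  have hk2 : (2 : ℝ) ≤ k := by rw [hk]; exact_mod_cast hA
  have hk0 : k ≠ 0 := by linarith
  have hk1 : k - 1 ≠ 0 := by linarith
  have h1 : ∀ p ∈ A, ((∑ i ∈ A.erase p, f i) / (A.erase p).card - c) ^ 2
      = (S / k - c) ^ 2 + 2 * (S / k - c) * ((S / k - f p) / (k - 1))
        + ((S / k) ^ 2 - 2 * (S / k) * f p + f p ^ 2) / (k - 1) ^ 2 := by
    intro p hp
    have e1 : ∑ i ∈ A.erase p, f i = S - f p := by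
      rw [hS, ← Finset.sum_erase_add _ _ hp]; ring
    have e2 : ((A.erase p).card : ℝ) = k - 1 := by
      rw [Finset.card_erase_of_mem hp, Nat.cast_pred (by omega)]
    rw [e1, e2]
    field_simp
    ring
  rw [Finset.sum_congr rfl h1, Finset.sum_add_distrib, Finset.sum_add_distrib, Finset.sum_const,
    ← Finset.mul_sum, ← Finset.sum_div, ← Finset.sum_div, Finset.sum_sub_distrib,
    Finset.sum_add_distrib, Finset.sum_sub_distrib, ← Finset.mul_sum, Finset.sum_const,
    Finset.sum_const, nsmul_eq_mul, nsmul_eq_mul, nsmul_eq_mul, ← hk, ← hS]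
  have e3 : k * (S / k) - S = 0 := by field_simp; ring
  have e4 : k * (S / k) ^ 2 - 2 * (S / k) * S + ∑ p ∈ A, f p ^ 2 ≤ ∑ p ∈ A, f p ^ 2 := by
    have : k * (S / k) ^ 2 - 2 * (S / k) * S = -(S ^ 2 / k) := by field_simp; ring
    have h0 : 0 ≤ S ^ 2 / k := by positivity
    linarith
  rw [e3, zero_div, mul_zero]
  have := div_le_div_of_nonneg_right e4 (sq_nonneg (k - 1))
  linarith

/-- Under removal of a uniformly random element, the second-moment matrix of the remaining rows is a
martingale, so that only the variance of the single increment is added. -/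
theorem sum_covDeviation_erase_le (Y : Matrix (Fin n) (Fin d) ℝ) {r : ℝ}
    (hY : ∀ i, Y i ⬝ᵥ Y i ≤ r ^ 2) (A : Finset (Fin n)) (hA : 2 ≤ A.card) :
    ∑ p ∈ A, covDeviation Y (A.erase p)
      ≤ A.card * (covDeviation Y A + r ^ 4 / ((A.card : ℝ) - 1) ^ 2) := by
  have h1 : ∀ a b, ∑ p ∈ A, ((∑ i ∈ A.erase p, Y i a * Y i b) / (A.erase p).card
        - (∑ i, Y i a * Y i b) / n) ^ 2
      ≤ A.card * ((∑ i ∈ A, Y i a * Y i b) / A.card - (∑ i, Y i a * Y i b) / n) ^ 2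
        + (∑ p ∈ A, (Y p a * Y p b) ^ 2) / ((A.card : ℝ) - 1) ^ 2 := fun a b =>
    sum_sq_mean_erase_le A hA (fun i => Y i a * Y i b) _
  have h2 : ∑ a, ∑ b, ∑ p ∈ A, (Y p a * Y p b) ^ 2 ≤ A.card * r ^ 4 := by
    have : ∀ p ∈ A, ∑ a, ∑ b, (Y p a * Y p b) ^ 2 ≤ r ^ 4 := by
      intro p _
      have e : ∑ a, ∑ b, (Y p a * Y p b) ^ 2 = (Y p ⬝ᵥ Y p) ^ 2 := by
        rw [sq (Y p ⬝ᵥ Y p), dotProduct, Finset.sum_mul_sum]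
        exact Finset.sum_congr rfl fun a _ => Finset.sum_congr rfl fun b _ => by ring
      rw [e]
      calc (Y p ⬝ᵥ Y p) ^ 2 ≤ (r ^ 2) ^ 2 :=
            pow_le_pow_left₀ (dotProduct_self_nonneg_real _) (hY p) 2
        _ = r ^ 4 := by ring
    calc ∑ a, ∑ b, ∑ p ∈ A, (Y p a * Y p b) ^ 2
        = ∑ p ∈ A, ∑ a, ∑ b, (Y p a * Y p b) ^ 2 :=
          (Finset.sum_congr rfl fun a _ => Finset.sum_comm).trans Finset.sum_comm
      _ ≤ _ := by
          refine (Finset.sum_le_sum this).trans_eq ?_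
          rw [Finset.sum_const, nsmul_eq_mul]
  have h3 : ∑ p ∈ A, covDeviation Y (A.erase p)
      = ∑ a, ∑ b, ∑ p ∈ A, ((∑ i ∈ A.erase p, Y i a * Y i b) / (A.erase p).card
        - (∑ i, Y i a * Y i b) / n) ^ 2 := by
    unfold covDeviation
    rw [Finset.sum_comm]
    exact Finset.sum_congr rfl fun a _ => Finset.sum_comm
  rw [h3]
  refine (Finset.sum_le_sum fun a _ => Finset.sum_le_sum fun b _ => h1 a b).trans ?_
  simp only [Finset.sum_add_distrib, ← Finset.mul_sum, ← Finset.sum_div]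
  rw [mul_add, ← mul_div_assoc]
  exact add_le_add le_rfl (div_le_div_of_nonneg_right h2 (sq_nonneg _))

/-- A Frobenius deviation of at most `1 / (2 κ)` costs at most half of the frame bound. -/
theorem frame_bound_of_covDeviation_le (Y : Matrix (Fin n) (Fin d) ℝ) {κ : ℝ} (hκ : 0 < κ)
    (hn : 0 < n) (hY : ∀ x : Fin d → ℝ, n / κ * (x ⬝ᵥ x) ≤ ∑ i, (Y i ⬝ᵥ x) ^ 2)
    {A : Finset (Fin n)} (hA : A.Nonempty) (h : 4 * κ ^ 2 * covDeviation Y A ≤ 1)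
    (x : Fin d → ℝ) : A.card / (2 * κ) * (x ⬝ᵥ x) ≤ ∑ i ∈ A, (Y i ⬝ᵥ x) ^ 2 := by
  have hk : (0 : ℝ) < A.card := by exact_mod_cast hA.card_pos
  have hn' : (0 : ℝ) < n := by exact_mod_cast hn
  have hx : 0 ≤ x ⬝ᵥ x := dotProduct_self_nonneg_real x
  have hexp : ∀ S : Finset (Fin n), ∑ i ∈ S, (Y i ⬝ᵥ x) ^ 2
      = ∑ a, ∑ b, (∑ i ∈ S, Y i a * Y i b) * (x a * x b) := by
    intro S
    have : ∀ i, (Y i ⬝ᵥ x) ^ 2 = ∑ a, ∑ b, (Y i a * Y i b) * (x a * x b) := by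
      intro i
      rw [sq, dotProduct, Finset.sum_mul_sum]
      exact Finset.sum_congr rfl fun a _ => Finset.sum_congr rfl fun b _ => by ring
    simp only [this, Finset.sum_mul]
    rw [Finset.sum_comm]
    exact Finset.sum_congr rfl fun a _ => Finset.sum_comm
  set D := (∑ i ∈ A, (Y i ⬝ᵥ x) ^ 2) / A.card - (∑ i, (Y i ⬝ᵥ x) ^ 2) / n with hD
  have hD1 : D = ∑ q : Fin d × Fin d, ((∑ i ∈ A, Y i q.1 * Y i q.2) / A.card
      - (∑ i, Y i q.1 * Y i q.2) / n) * (x q.1 * x q.2) := by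
    rw [hD, hexp, hexp, Fintype.sum_prod_type, Finset.sum_div, Finset.sum_div,
      ← Finset.sum_sub_distrib]
    refine Finset.sum_congr rfl fun a _ => ?_
    rw [Finset.sum_div, Finset.sum_div, ← Finset.sum_sub_distrib]
    exact Finset.sum_congr rfl fun b _ => by ring
  have hD2 : D ^ 2 ≤ covDeviation Y A * (x ⬝ᵥ x) ^ 2 := by
    rw [hD1]
    refine (Finset.sum_mul_sq_le_sq_mul_sq _ _ _).trans_eq ?_
    have e1 : ∑ q : Fin d × Fin d, (x q.1 * x q.2) ^ 2 = (x ⬝ᵥ x) ^ 2 := by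
      rw [Fintype.sum_prod_type, sq (x ⬝ᵥ x), dotProduct, Finset.sum_mul_sum]
      exact Finset.sum_congr rfl fun a _ => Finset.sum_congr rfl fun b _ => by ring
    rw [e1, Fintype.sum_prod_type]
    rfl
  have hD3 : (2 * κ * D) ^ 2 ≤ (x ⬝ᵥ x) ^ 2 := by
    nlinarith [mul_le_mul_of_nonneg_left hD2 (by positivity : 0 ≤ 4 * κ ^ 2),
      mul_le_mul_of_nonneg_right h (sq_nonneg (x ⬝ᵥ x))]
  have hD4 : -(x ⬝ᵥ x) ≤ 2 * κ * D := (abs_le.1 (abs_le_of_sq_le_sq hD3 hx)).1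
  have h3 : (x ⬝ᵥ x) / κ ≤ (∑ i, (Y i ⬝ᵥ x) ^ 2) / n := by
    rw [le_div_iff₀ hn']
    refine le_trans (le_of_eq ?_) (hY x)
    ring
  have h4 : -((x ⬝ᵥ x) / (2 * κ)) ≤ D := by
    rw [← neg_div, div_le_iff₀ (by positivity)]; linarith
  have h5 : (x ⬝ᵥ x) / (2 * κ) ≤ (∑ i ∈ A, (Y i ⬝ᵥ x) ^ 2) / A.card := by
    have : (x ⬝ᵥ x) / κ = (x ⬝ᵥ x) / (2 * κ) + (x ⬝ᵥ x) / (2 * κ) := by field_simp; ring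
    linarith
  rw [le_div_iff₀ hk] at h5
  refine le_trans (le_of_eq ?_) h5
  ring

end Potentials

/-! ### Comparison along the walk -/

section Comparison

variable {n d : ℕ} {m : Type*} [Fintype m]

/-- The standing assumptions for the quantitative estimates: `‖B w‖² = c wᵀ(I + Y Yᵀ)w`, the rows
of `Y` have norm at most `r`, `Yᵀ Y ≥ (n / κ) I`, and the estimates are used as long as at least
`k₀` coordinates are active and these are bounded by `η`. -/
structure WalkBounds (B : Matrix m (Fin n) ℝ) (Y : Matrix (Fin n) (Fin d) ℝ) (c r κ η : ℝ)
    (k₀ : ℕ) : Prop where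
  c_pos : 0 < c
  norm_sq : ∀ w, euclNorm (B *ᵥ w) ^ 2 = c * covForm Y w w
  r_nonneg : 0 ≤ r
  row_le : ∀ i, Y i ⬝ᵥ Y i ≤ r ^ 2
  κ_pos : 0 < κ
  frame : ∀ x : Fin d → ℝ, n / κ * (x ⬝ᵥ x) ≤ ∑ i, (Y i ⬝ᵥ x) ^ 2
  η_pos : 0 < η
  η_le : η ≤ 1 / 2
  k₀_pos : 0 < k₀
  k₀_large : 32 * r ^ 2 * κ ≤ k₀

/-- The bound for the speed of the non-pivot coordinates while `k₀` coordinates are active. -/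
def speedBound (r κ : ℝ) (k₀ : ℕ) : ℝ := 4 * r ^ 2 * κ / k₀

/-- The active rows of `Y` are well conditioned and the active coordinates are small. -/
def IsGood (Y : Matrix (Fin n) (Fin d) ℝ) (κ η : ℝ) (s : State n) : Prop :=
  4 * κ ^ 2 * covDeviation Y s.active ≤ 1 ∧ ∀ j ∈ s.active, |s.z j| ≤ η

/-- A supermartingale on good states that is at least `1` on bad ones. -/
def badPotential (Y : Matrix (Fin n) (Fin d) ℝ) (r κ η : ℝ) (k₀ : ℕ) (s : State n) : ℝ :=
  4 * κ ^ 2 * (covDeviation Y s.active + r ^ 4 / k₀ ^ 2 * s.active.card)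
    + (η ^ 4)⁻¹ * driftPotential (speedBound r κ k₀) s

variable {B : Matrix m (Fin n) ℝ} {Y : Matrix (Fin n) (Fin d) ℝ} {c r κ η : ℝ} {k₀ : ℕ}
  {s : State n} {v : Fin n → ℝ}

theorem WalkBounds.speedBound_nonneg (h : WalkBounds B Y c r κ η k₀) : 0 ≤ speedBound r κ k₀ := by
  have := h.κ_pos
  unfold speedBound; positivity

theorem WalkBounds.speedBound_le (h : WalkBounds B Y c r κ η k₀) :
    speedBound r κ k₀ ≤ 1 / 8 := by
  have h0 : (0 : ℝ) < k₀ := by exact_mod_cast h.k₀_pos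
  rw [speedBound, div_le_iff₀ h0]
  linarith [h.k₀_large]

theorem WalkBounds.badPotential_nonneg (h : WalkBounds B Y c r κ η k₀) (s : State n) :
    0 ≤ badPotential Y r κ η k₀ s := by
  have h1 := covDeviation_nonneg Y s.active
  have h2 := driftPotential_nonneg (speedBound r κ k₀) s
  have h3 := h.η_pos
  unfold badPotential; positivity

theorem WalkBounds.one_le_badPotential (h : WalkBounds B Y c r κ η k₀) (hs : ¬ IsGood Y κ η s) :
    1 ≤ badPotential Y r κ η k₀ s := by
  have h1 := covDeviation_nonneg Y s.active
  have h2 := driftPotential_nonneg (speedBound r κ k₀) s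
  have h3 := h.η_pos
  have h4 : 0 ≤ r ^ 4 / (k₀ : ℝ) ^ 2 * s.active.card := by positivity
  unfold badPotential
  rw [mul_add]
  by_cases hc : 4 * κ ^ 2 * covDeviation Y s.active ≤ 1
  · simp only [IsGood, hc, true_and, not_forall, not_le] at hs
    obtain ⟨j, hj, hz⟩ := hs
    have h5 := pow_le_driftPotential (β := speedBound r κ k₀) h3.le hj hz.le
    have h6 : 1 ≤ (η ^ 4)⁻¹ * driftPotential (speedBound r κ k₀) s := by
      rw [inv_mul_eq_div, one_le_div (by positivity)]
      exact h5
    have h7 : 0 ≤ 4 * κ ^ 2 * covDeviation Y s.active := by positivity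
    have h8 : 0 ≤ 4 * κ ^ 2 * (r ^ 4 / (k₀ : ℝ) ^ 2 * s.active.card) := by positivity
    linarith
  · have h6 : 0 ≤ (η ^ 4)⁻¹ * driftPotential (speedBound r κ k₀) s := by positivity
    have h8 : 0 ≤ 4 * κ ^ 2 * (r ^ 4 / (k₀ : ℝ) ^ 2 * s.active.card) := by positivity
    linarith

section GoodState

variable {p : Fin n}

theorem WalkBounds.isPivotDirection (h : WalkBounds B Y c r κ η k₀) (hp : p ∈ s.active) :
    IsPivotDirection Y s.active p (stepDirection B s.active p) :=
  isPivotDirection_stepDirection h.c_pos h.norm_sq hp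

/-- With `h = uᵀ Y`, the quantity `r ‖h‖` bounds both the speed of the non-pivot coordinates and
`covForm u u - 1`. -/
theorem WalkBounds.norm_vecMul_le (h : WalkBounds B Y c r κ η k₀) (hg : IsGood Y κ η s)
    (hk : k₀ ≤ s.active.card) (hp : p ∈ s.active) :
    r * euclNorm (stepDirection B s.active p ᵥ* Y) ≤ speedBound r κ k₀ := by
  have hκ := h.κ_pos
  have hr := h.r_nonneg
  have hk0 : (0 : ℝ) < k₀ := by exact_mod_cast h.k₀_pos
  have hkk : (k₀ : ℝ) ≤ s.active.card := by exact_mod_cast hk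
  have hn : 0 < n := Fin.pos p
  have hkA : (0 : ℝ) < s.active.card := hk0.trans_le hkk
  have h1 : 2 * r ^ 2 ≤ s.active.card / (2 * κ) := by
    rw [le_div_iff₀ (by positivity)]
    nlinarith [h.k₀_large, mul_nonneg (sq_nonneg r) hκ.le]
  have h2 := (h.isPivotDirection hp).euclNorm_vecMul_le hp hr (h.row_le p) h1 (by positivity)
    (frame_bound_of_covDeviation_le Y hκ hn h.frame ⟨p, hp⟩ hg.1)
  have h3 : 2 * r / (s.active.card / (2 * κ)) ≤ 4 * r * κ / k₀ := by
    rw [div_div_eq_mul_div, div_le_div_iff₀ hkA hk0]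
    nlinarith [mul_le_mul_of_nonneg_left hkk (mul_nonneg hr hκ.le)]
  calc r * euclNorm (stepDirection B s.active p ᵥ* Y) ≤ r * (4 * r * κ / k₀) :=
        mul_le_mul_of_nonneg_left (h2.trans h3) hr
    _ = speedBound r κ k₀ := by unfold speedBound; ring

theorem WalkBounds.abs_dotProduct_le (h : WalkBounds B Y c r κ η k₀) (i : Fin n)
    (x : Fin d → ℝ) : |Y i ⬝ᵥ x| ≤ r * euclNorm x := by
  refine abs_le_of_sq_le_sq ?_ (mul_nonneg h.r_nonneg (euclNorm_nonneg x))
  rw [mul_pow, euclNorm_sq]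
  exact (dotProduct_sq_le _ _).trans
    (mul_le_mul_of_nonneg_right (h.row_le i) (dotProduct_self_nonneg_real x))

theorem WalkBounds.isFree (h : WalkBounds B Y c r κ η k₀) (hr : IsRegular s)
    (hg : IsGood Y κ η s) (hk : k₀ ≤ s.active.card) :
    IsFree B η (speedBound r κ k₀) s where
  regular := hr
  nonempty := Finset.card_pos.1 (h.k₀_pos.trans_le hk)
  abs_z_le := hg.2
  pivot_eq p hp := (h.isPivotDirection hp).2.1
  supp p hp := (h.isPivotDirection hp).1
  speed p hp j hj := by
    by_cases hjA : j ∈ s.active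
    · rw [(h.isPivotDirection hp).coord_eq hjA hj, abs_neg]
      exact (h.abs_dotProduct_le j _).trans (h.norm_vecMul_le hg hk hp)
    · rw [(h.isPivotDirection hp).1 j hjA, abs_zero]
      exact h.speedBound_nonneg
  margin := by linarith [h.η_le, h.speedBound_le]

theorem WalkBounds.covForm_self_le (h : WalkBounds B Y c r κ η k₀) (hg : IsGood Y κ η s)
    (hk : k₀ ≤ s.active.card) (hp : p ∈ s.active) :
    covForm Y (stepDirection B s.active p) (stepDirection B s.active p)
      ≤ 1 + speedBound r κ k₀ := by
  rw [(h.isPivotDirection hp).covForm_self_eq_one_add hp]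
  linarith [le_abs_self (Y p ⬝ᵥ (stepDirection B s.active p ᵥ* Y)),
    h.abs_dotProduct_le p (stepDirection B s.active p ᵥ* Y), h.norm_vecMul_le hg hk hp]

/-- The increments of `⟨z, v⟩` at good states are uniformly small. -/
theorem WalkBounds.abs_dotProduct_stepDirection_le (h : WalkBounds B Y c r κ η k₀)
    (hg : IsGood Y κ η s) (hk : k₀ ≤ s.active.card) (hp : p ∈ s.active) (v : Fin n → ℝ) :
    |v ⬝ᵥ stepDirection B s.active p| ≤ ‖v‖ + euclNorm v * √(speedBound r κ k₀) := by
  have hdir := h.isPivotDirection (s := s) hp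
  set u := stepDirection B s.active p with hu
  set w : Fin n → ℝ := u + (-1 : ℝ) • Pi.single p 1 with hw
  have h1 : v ⬝ᵥ u = v p + v ⬝ᵥ w := by
    simp [hw, dotProduct_add]
  have h2 : w ⬝ᵥ w ≤ speedBound r κ k₀ := by
    have e1 : w ⬝ᵥ w = u ⬝ᵥ u - 1 := by
      simp only [hw, dotProduct_add, add_dotProduct, smul_dotProduct, dotProduct_smul,
        single_one_dotProduct, dotProduct_single_one, hdir.2.1, smul_eq_mul, Pi.add_apply, Pi.smul_apply,
        Pi.single_eq_same]
      ring
    linarith [dotProduct_self_le_covForm Y u, h.covForm_self_le hg hk hp]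
  have h3 : |v p| ≤ ‖v‖ := by simpa using norm_le_pi_norm v p
  have h4 : |v ⬝ᵥ w| ≤ euclNorm v * √(speedBound r κ k₀) := by
    refine abs_le_of_sq_le_sq ?_ (mul_nonneg (euclNorm_nonneg v) (Real.sqrt_nonneg _))
    rw [mul_pow, euclNorm_sq, Real.sq_sqrt h.speedBound_nonneg]
    exact (dotProduct_sq_le _ _).trans
      (mul_le_mul_of_nonneg_left h2 (dotProduct_self_nonneg_real v))
  rw [h1]
  exact (abs_add_le _ _).trans (add_le_add h3 h4)

end GoodState

theorem WalkBounds.stepMean_badPotential_le (h : WalkBounds B Y c r κ η k₀) (hr : IsRegular s)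
    (hg : IsGood Y κ η s) (hk : k₀ < s.active.card) :
    stepMean B (badPotential Y r κ η k₀) s ≤ badPotential Y r κ η k₀ s := by
  have hf := h.isFree hr hg hk.le
  have hk0 : (0 : ℝ) < k₀ := by exact_mod_cast h.k₀_pos
  have hkA : (0 : ℝ) < s.active.card := by exact_mod_cast hf.nonempty.card_pos
  have hkk : (k₀ : ℝ) ≤ (s.active.card : ℝ) - 1 := by
    have : ((k₀ + 1 : ℕ) : ℝ) ≤ s.active.card := by exact_mod_cast hk
    push_cast at this; linarith
  have h1 := hf.stepMean_driftPotential_le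
  have h2 : stepMean B (fun s => covDeviation Y s.active + r ^ 4 / k₀ ^ 2 * s.active.card) s
      ≤ covDeviation Y s.active + r ^ 4 / k₀ ^ 2 * s.active.card := by
    rw [hf.stepMean_active fun A => covDeviation Y A + r ^ 4 / k₀ ^ 2 * A.card,
      inv_mul_le_iff₀ hkA, Finset.sum_add_distrib]
    have e1 := sum_covDeviation_erase_le Y h.row_le s.active (by have := h.k₀_pos; omega)
    have e2 : ∑ p ∈ s.active, r ^ 4 / (k₀ : ℝ) ^ 2 * ((s.active.erase p).card : ℝ)
        = s.active.card * (r ^ 4 / (k₀ : ℝ) ^ 2 * ((s.active.card : ℝ) - 1)) := by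
      rw [← nsmul_eq_mul, ← Finset.sum_const]
      refine Finset.sum_congr rfl fun p hp => ?_
      rw [Finset.card_erase_of_mem hp, Nat.cast_pred hf.nonempty.card_pos]
    have e3 : r ^ 4 / ((s.active.card : ℝ) - 1) ^ 2 ≤ r ^ 4 / (k₀ : ℝ) ^ 2 :=
      div_le_div_of_nonneg_left (by positivity) (by positivity)
        (pow_le_pow_left₀ hk0.le hkk 2)
    rw [e2]
    nlinarith [mul_le_mul_of_nonneg_left e3 hkA.le]
  have h3 : 0 ≤ (η ^ 4)⁻¹ := by have := h.η_pos; positivity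
  have h4 : 0 ≤ 4 * κ ^ 2 := by positivity
  calc stepMean B (badPotential Y r κ η k₀) s
      = 4 * κ ^ 2 * stepMean B
          (fun s => covDeviation Y s.active + r ^ 4 / k₀ ^ 2 * s.active.card) s
        + (η ^ 4)⁻¹ * stepMean B (driftPotential (speedBound r κ k₀)) s := by
        rw [← stepMean_mul_left, ← stepMean_mul_left, ← stepMean_add]; rfl
    _ ≤ _ := add_le_add (mul_le_mul_of_nonneg_left h2 h4) (mul_le_mul_of_nonneg_left h1 h3)

/-- Comparison principle. If `g` is almost invariant under one round at good states, with an error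
controlled by the decrease of `residualVar`, and if `g` approximates the final value of `f` when
only `k₀` coordinates are left, then it does so from the start; bad states cost at most `C₁` times
their potential. -/
theorem WalkBounds.norm_iterate_sub_le {E : Type*} [NormedAddCommGroup E] [NormedSpace ℝ E]
    (h : WalkBounds B Y c r κ η k₀) {f g : State n → E} {C₁ C₂ ω ν : ℝ} (hC₁ : 0 ≤ C₁)
    (hC₂ : 0 ≤ C₂) (hω : 0 ≤ ω) (hν : 0 ≤ ν)
    (hbad : ∀ s, IsRegular s → ¬ IsGood Y κ η s →
      ‖(stepMean B)^[s.active.card] f s - g s‖ ≤ C₁)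
    (hgood : ∀ s, IsRegular s → IsGood Y κ η s → k₀ < s.active.card →
      ‖stepMean B g s - g s‖ ≤ ω * (residualVar Y v s.active
        - (s.active.card : ℝ)⁻¹ * ∑ p ∈ s.active, residualVar Y v (s.active.erase p)))
    (hlast : ∀ s, IsRegular s → s.active.card = k₀ →
      ‖(stepMean B)^[s.active.card] f s - g s‖ ≤ ν + C₂ * ∑ i ∈ s.active, v i ^ 2)
    {k : ℕ} (hk : k₀ ≤ k) {s : State n} (hs : IsRegular s) (hsk : s.active.card = k) :
    ‖(stepMean B)^[s.active.card] f s - g s‖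
      ≤ C₁ * badPotential Y r κ η k₀ s + ω * residualVar Y v s.active + ν
        + C₂ * (k₀ / s.active.card) * ∑ i ∈ s.active, v i ^ 2 := by
  have hk0 : (0 : ℝ) < k₀ := by exact_mod_cast h.k₀_pos
  have hnn : ∀ s : State n, 0 ≤ C₁ * badPotential Y r κ η k₀ s :=
    fun s => mul_nonneg hC₁ (h.badPotential_nonneg s)
  have hRn : ∀ s : State n, 0 ≤ ω * residualVar Y v s.active :=
    fun s => mul_nonneg hω (residualVar_nonneg Y v _)
  have hVn : ∀ s : State n, 0 ≤ C₂ * (k₀ / s.active.card) * ∑ i ∈ s.active, v i ^ 2 :=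
    fun s => mul_nonneg (by positivity) (Finset.sum_nonneg fun _ _ => sq_nonneg _)
  induction k, hk using Nat.le_induction generalizing s with
  | base =>
    refine (hlast s hs hsk).trans ?_
    rw [hsk, div_self hk0.ne']
    linarith [hnn s, hRn s]
  | succ k hk ih =>
    by_cases hg : IsGood Y κ η s
    · have hf := h.isFree hs hg (by omega)
      have hk1 : (0 : ℝ) < k := by
        exact_mod_cast h.k₀_pos.trans_le hk
      have hkA : (s.active.card : ℝ) = k + 1 := by rw [hsk]; push_cast; rfl
      set F : State n → ℝ := fun s => C₁ * badPotential Y r κ η k₀ s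
        + ω * residualVar Y v s.active + ν + C₂ * (k₀ / k) * ∑ i ∈ s.active, v i ^ 2 with hF
      have h1 : stepMean B (fun s => ‖(stepMean B)^[k] f s - g s‖) s ≤ stepMean B F s := by
        refine hf.stepMean_le fun s' hs' hcard => ?_
        have hc' : s'.active.card = k := by omega
        have := ih hs' hc'
        rw [hc'] at this
        exact this
      have h2 : stepMean B F s = C₁ * stepMean B (badPotential Y r κ η k₀) s
          + ω * stepMean B (fun s => residualVar Y v s.active) s + ν
          + C₂ * (k₀ / k) * stepMean B (fun s => ∑ i ∈ s.active, v i ^ 2) s := by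
        rw [hF, stepMean_add, stepMean_add, stepMean_add, stepMean_mul_left, stepMean_mul_left,
          stepMean_mul_left, stepMean_const]
      have h3 : C₂ * (k₀ / k) * stepMean B (fun s => ∑ i ∈ s.active, v i ^ 2) s
          = C₂ * (k₀ / s.active.card) * ∑ i ∈ s.active, v i ^ 2 := by
        rw [hf.stepMean_active fun A => ∑ i ∈ A, v i ^ 2]
        have : ∑ p ∈ s.active, ∑ i ∈ s.active.erase p, v i ^ 2
            = k * ∑ i ∈ s.active, v i ^ 2 := by
          have e : ∀ p ∈ s.active, ∑ i ∈ s.active.erase p, v i ^ 2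
              = ∑ i ∈ s.active, v i ^ 2 - v p ^ 2 := fun p hp => by
            rw [← Finset.sum_erase_add _ _ hp]; ring
          rw [Finset.sum_congr rfl e, Finset.sum_sub_distrib, Finset.sum_const, nsmul_eq_mul, hkA]
          ring
        rw [this, hkA]
        field_simp
      have h4 := hf.stepMean_active (residualVar Y v)
      have h5 := mul_le_mul_of_nonneg_left (h.stepMean_badPotential_le hs hg (by omega)) hC₁
      have h6 := hgood s hs hg (by omega)
      have h7 : (stepMean B)^[s.active.card] f s - g s
          = stepMean B (fun s => (stepMean B)^[k] f s - g s) s + (stepMean B g s - g s) := by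
        rw [stepMean_sub, hsk, Function.iterate_succ_apply']
        abel
      rw [h7]
      refine (norm_add_le _ _).trans ((add_le_add ((norm_stepMean_le B _ s).trans h1) h6).trans ?_)
      rw [h2, h3, h4]
      linarith
    · have h1 := mul_le_mul_of_nonneg_left (h.one_le_badPotential hg) hC₁
      have h2 := hbad s hs hg
      linarith [hRn s, hVn s]

end Comparison

/-! ### Quantitative estimates for the variance and the characteristic function -/

section Estimates

variable {n d : ℕ} {m : Type*} [Fintype m] {B : Matrix m (Fin n) ℝ}
  {Y : Matrix (Fin n) (Fin d) ℝ} {c r κ η : ℝ} {k₀ : ℕ} {s : State n} {v : Fin n → ℝ}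

theorem initState_isRegular (n : ℕ) : IsRegular (initState n) := by
  refine ⟨?_, fun i => by simp [initState]⟩
  rintro ⟨p, -, hp⟩
  simp [initState] at hp

theorem badPotential_initState (r κ η : ℝ) (k₀ : ℕ) :
    badPotential Y r κ η k₀ (initState n)
      = 4 * κ ^ 2 * (r ^ 4 / k₀ ^ 2 * n)
        + (η ^ 4)⁻¹ * (n * (5 * n * speedBound r κ k₀ ^ 2) ^ 2) := by
  simp [badPotential, initState, covDeviation_univ, driftPotential]

theorem sum_sq_le_one (hv : v ⬝ᵥ v = 1) (A : Finset (Fin n)) : ∑ i ∈ A, v i ^ 2 ≤ 1 := by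
  rw [← hv, dotProduct]
  simp only [← sq]
  exact Finset.sum_le_sum_of_subset_of_nonneg (Finset.subset_univ A) fun _ _ _ => sq_nonneg _

theorem residualVar_le_one (hv : v ⬝ᵥ v = 1) (A : Finset (Fin n)) : residualVar Y v A ≤ 1 :=
  (residualVar_le_sum Y v A).trans (sum_sq_le_one hv A)

theorem WalkBounds.one_add_row_le (h : WalkBounds B Y c r κ η k₀) (i : Fin n) :
    1 + Y i ⬝ᵥ Y i ≤ 1 + r ^ 2 := by linarith [h.row_le i]

theorem WalkBounds.iterate_sq_le (h : WalkBounds B Y c r κ η k₀) (hs : IsRegular s) (a : ℝ)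
    (k : ℕ) : (stepMean B)^[k] (fun s => (s.z ⬝ᵥ v - a) ^ 2) s
      ≤ (s.z ⬝ᵥ v - a) ^ 2 + (1 + r ^ 2) * residualVar Y v s.active := by
  have := iterate_stepMean_sq_le (v := v) h.c_pos h.norm_sq h.one_add_row_le
    (by positivity) a k hs.2
  rwa [varPotential_of_not_pivotActive hs.1] at this

theorem freeNext_dotProduct (B : Matrix m (Fin n) ℝ) (s : State n) (p : Fin n) (δ : ℝ) :
    (freeNext B s p δ).z ⬝ᵥ v = s.z ⬝ᵥ v + δ * (v ⬝ᵥ stepDirection B s.active p) := by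
  simp [freeNext, add_dotProduct, smul_dotProduct, dotProduct_comm v]

/-- The variance created by a pivot at a good state agrees with the decrease of `residualVar` up
to a small relative error. -/
theorem WalkBounds.abs_variance_sub_le (h : WalkBounds B Y c r κ η k₀) (hg : IsGood Y κ η s)
    (hk : k₀ ≤ s.active.card) {p : Fin n} (hp : p ∈ s.active) :
    |(v ⬝ᵥ stepDirection B s.active p) ^ 2 * (1 - s.z p ^ 2)
        - (residualVar Y v s.active - residualVar Y v (s.active.erase p))|
      ≤ (speedBound r κ k₀ + 2 * η ^ 2)
        * (residualVar Y v s.active - residualVar Y v (s.active.erase p)) := by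
  have hdir := h.isPivotDirection (s := s) hp
  rw [hdir.residualVar_erase hp v]
  set q := covForm Y (stepDirection B s.active p) (stepDirection B s.active p)
  set D := residualVar Y v s.active - residualVar Y v (s.active.erase p) with hD
  have hD0 : 0 ≤ D := sub_nonneg.2 (residualVar_mono Y v (Finset.erase_subset _ _))
  have h1 : 1 ≤ q := hdir.one_le
  have h2 : q ≤ 1 + speedBound r κ k₀ := h.covForm_self_le hg hk hp
  have h3 : s.z p ^ 2 ≤ η ^ 2 := by
    rw [← sq_abs]
    exact pow_le_pow_left₀ (abs_nonneg _) (hg.2 p hp) 2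
  have h4 := h.speedBound_le
  have h5 : q * s.z p ^ 2 ≤ 2 * η ^ 2 :=
    mul_le_mul (by linarith) h3 (sq_nonneg _) (by norm_num)
  have h6 : 0 ≤ q * s.z p ^ 2 := mul_nonneg (by linarith) (sq_nonneg _)
  have e : q * D * (1 - s.z p ^ 2) - D = ((q - 1) - q * s.z p ^ 2) * D := by ring
  rw [e, abs_mul, abs_of_nonneg hD0]
  refine mul_le_mul_of_nonneg_right (abs_le.2 ⟨?_, ?_⟩) hD0
  · linarith [h.speedBound_nonneg]
  · linarith [sq_nonneg η]

theorem avg_sub_eq (A : Finset (Fin n)) (hA : A.Nonempty) (R : Finset (Fin n) → ℝ) :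
    R A - (A.card : ℝ)⁻¹ * ∑ p ∈ A, R (A.erase p)
      = (A.card : ℝ)⁻¹ * ∑ p ∈ A, (R A - R (A.erase p)) := by
  have : (A.card : ℝ) ≠ 0 := by exact_mod_cast hA.card_pos.ne'
  rw [Finset.sum_sub_distrib, Finset.sum_const, nsmul_eq_mul, mul_sub, inv_mul_cancel_left₀ this]

/-- The comparison principle for `⟨z, v⟩² + R(A)`; for a unit vector `v` with `vᵀ Y = 0` its initial
value is `1`. -/
theorem WalkBounds.variance_estimate (h : WalkBounds B Y c r κ η k₀) (hk : k₀ ≤ n)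
    (hv : v ⬝ᵥ v = 1) (hvY : v ᵥ* Y = 0) :
    |(stepMean B)^[n] (fun s => (s.z ⬝ᵥ v) ^ 2) (initState n) - 1|
      ≤ (1 + r ^ 2) * badPotential Y r κ η k₀ (initState n)
        + (speedBound r κ k₀ + 2 * η ^ 2) + (1 + r ^ 2) * (k₀ / n) := by
  have hdiff : ∀ s, IsRegular s → ‖(stepMean B)^[s.active.card] (fun s => (s.z ⬝ᵥ v) ^ 2) s
      - ((s.z ⬝ᵥ v) ^ 2 + residualVar Y v s.active)‖ ≤ (1 + r ^ 2) * residualVar Y v s.active := by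
    intro s hs
    have h1 := h.iterate_sq_le (v := v) hs 0 s.active.card
    simp only [sub_zero] at h1
    have h2 := le_iterate_stepMean_sq (B := B) (v := v) s.active.card s
    have h3 := residualVar_nonneg Y v s.active
    have h4 : 0 ≤ r ^ 2 * residualVar Y v s.active := by positivity
    rw [Real.norm_eq_abs, abs_le]
    constructor <;> linarith
  have key := h.norm_iterate_sub_le (v := v) (f := fun s => (s.z ⬝ᵥ v) ^ 2)
    (g := fun s => (s.z ⬝ᵥ v) ^ 2 + residualVar Y v s.active)
    (C₁ := 1 + r ^ 2) (C₂ := 1 + r ^ 2) (ω := speedBound r κ k₀ + 2 * η ^ 2) (ν := 0)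
    (by positivity) (by positivity) (add_nonneg h.speedBound_nonneg (by positivity)) le_rfl
    (fun s hs _ => (hdiff s hs).trans
      (mul_le_of_le_one_right (by positivity) (residualVar_le_one hv _)))
    (fun s hs hg hk => by
      have hf := h.isFree hs hg hk.le
      have hkA : (0 : ℝ) < s.active.card := by exact_mod_cast hf.nonempty.card_pos
      have e1 : stepMean B (fun s => (s.z ⬝ᵥ v) ^ 2 + residualVar Y v s.active) s
          - ((s.z ⬝ᵥ v) ^ 2 + residualVar Y v s.active)
          = (s.active.card : ℝ)⁻¹ * ∑ p ∈ s.active,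
              ((v ⬝ᵥ stepDirection B s.active p) ^ 2 * (1 - s.z p ^ 2)
                - (residualVar Y v s.active - residualVar Y v (s.active.erase p))) := by
        rw [stepMean_add, hf.stepMean_active (residualVar Y v), hf.stepMean_eq, smul_eq_mul]
        have e2 : ∀ p ∈ s.active, sizeMean s.z (stepDirection B s.active p)
            (fun δ => ((freeNext B s p δ).z ⬝ᵥ v) ^ 2)
            = (s.z ⬝ᵥ v) ^ 2 + (v ⬝ᵥ stepDirection B s.active p) ^ 2 * (1 - s.z p ^ 2) := by
          intro p hp
          rw [← hf.sizeMean_sq hp, ← sizeMean_quadratic _ _ _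
            (2 * (s.z ⬝ᵥ v) * (v ⬝ᵥ stepDirection B s.active p))]
          congr 1
          ext δ
          rw [freeNext_dotProduct]
          ring
        rw [Finset.sum_congr rfl e2, Finset.sum_sub_distrib, mul_sub,
          ← avg_sub_eq _ hf.nonempty, Finset.sum_add_distrib, Finset.sum_const, nsmul_eq_mul,
          mul_add, inv_mul_cancel_left₀ hkA.ne']
        ring
      rw [e1, avg_sub_eq _ hf.nonempty, Real.norm_eq_abs, abs_mul, abs_of_nonneg (by positivity),
        mul_left_comm]
      refine mul_le_mul_of_nonneg_left ?_ (by positivity)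
      rw [Finset.mul_sum]
      exact (Finset.abs_sum_le_sum_abs _ _).trans
        (Finset.sum_le_sum fun p hp => h.abs_variance_sub_le hg hk.le hp))
    (fun s hs _ => by
      rw [zero_add]
      exact (hdiff s hs).trans
        (mul_le_mul_of_nonneg_left (residualVar_le_sum Y v _) (by positivity)))
    hk (initState_isRegular n) (by simp [initState])
  have e3 : residualVar Y v (initState n).active = 1 := by
    rw [← hv]; exact residualVar_univ Y hvY
  have e4 : ∑ i ∈ (initState n).active, v i ^ 2 = 1 := by
    rw [← hv]; simp [initState, dotProduct, sq]
  have e5 : (initState n).active.card = n := by simp [initState]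
  have e6 : (initState n).z ⬝ᵥ v = 0 := by simp [initState]
  rw [e3, e4, e5, Real.norm_eq_abs] at key
  simp only [e6] at key
  norm_num at key ⊢
  linarith

open Complex in
theorem norm_exp_sub_quadratic_le {x : ℝ} (hx : |x| ≤ 1) :
    ‖cexp (x * I) - (1 + x • I - (x ^ 2) • (1 / 2 : ℂ))‖ ≤ |x| ^ 3 := by
  have h1 : ‖(x : ℂ) * I‖ = |x| := by simp
  have h2 := Complex.exp_bound (x := (x : ℂ) * I) (by rw [h1]; exact hx) (n := 3) (by norm_num)
  rw [h1] at h2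
  simp only [Finset.sum_range_succ, Finset.sum_range_zero] at h2
  have e : (1 : ℂ) + x • I - (x ^ 2) • (1 / 2 : ℂ)
      = 0 + (↑x * I) ^ 0 / (Nat.factorial 0 : ℂ) + (↑x * I) ^ 1 / (Nat.factorial 1 : ℂ)
        + (↑x * I) ^ 2 / (Nat.factorial 2 : ℂ) := by
    simp [mul_pow, Nat.factorial]
    ring
  rw [e]
  refine h2.trans (mul_le_of_le_one_right (by positivity) ?_)
  norm_num [Nat.factorial]

theorem sizeMean_smul_const {E : Type*} [NormedAddCommGroup E] [NormedSpace ℝ E]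
    (z u : Fin n → ℝ) (f : ℝ → ℝ) (a : E) :
    sizeMean z u (fun δ => f δ • a) = sizeMean z u f • a := by
  simp only [sizeMean, smul_smul, ← add_smul, smul_eq_mul]

theorem sizeMean_mul_left_complex (z u : Fin n → ℝ) (a : ℂ) (f : ℝ → ℂ) :
    sizeMean z u (fun δ => a * f δ) = a * sizeMean z u f := by
  simp only [sizeMean, mul_add, mul_smul_comm]

open Complex in
/-- The characteristic function of a single increment at a good state is that of a Gaussian with
variance equal to the decrease of `residualVar`, up to a small relative error. -/
theorem WalkBounds.norm_charFun_step_le (h : WalkBounds B Y c r κ η k₀) (hs : IsRegular s)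
    (hg : IsGood Y κ η s) (hk : k₀ ≤ s.active.card) {p : Fin n} (hp : p ∈ s.active) {θ α : ℝ}
    (hα : ∀ p ∈ s.active, |v ⬝ᵥ stepDirection B s.active p| ≤ α) (hθ : 2 * |θ| * α ≤ 1) :
    ‖sizeMean s.z (stepDirection B s.active p)
        (fun δ => cexp ((θ * (δ * (v ⬝ᵥ stepDirection B s.active p)) : ℝ) * I))
      - (Real.exp (-(θ ^ 2
          * (residualVar Y v s.active - residualVar Y v (s.active.erase p)) / 2)) : ℂ)‖
      ≤ (4 * |θ| ^ 3 * α + θ ^ 2 * (speedBound r κ k₀ + 2 * η ^ 2) + θ ^ 4 * α ^ 2)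
        * (residualVar Y v s.active - residualVar Y v (s.active.erase p)) := by
  have hf := h.isFree hs hg hk
  have hdir := h.isPivotDirection (s := s) hp
  have hvar := h.abs_variance_sub_le (v := v) hg hk hp
  have hsq := hdir.residualVar_erase hp v
  have hq1 := hdir.one_le
  have hq2 := h.covForm_self_le hg hk hp
  have hβ := h.speedBound_le
  have hap := hα p hp
  have hsz := hf.sizeMean_sq hp
  set u := stepDirection B s.active p
  set a := v ⬝ᵥ u
  set D := residualVar Y v s.active - residualVar Y v (s.active.erase p) with hD
  have hD0 : 0 ≤ D := sub_nonneg.2 (residualVar_mono Y v (Finset.erase_subset _ _))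
  have hα0 : 0 ≤ α := (abs_nonneg _).trans hap
  have ha2 : a ^ 2 ≤ 2 * D := by
    rw [hsq]; exact mul_le_mul_of_nonneg_right (by linarith) hD0
  have hDa : D ≤ a ^ 2 := by
    rw [hsq]; exact le_mul_of_one_le_left hD0 hq1
  have haα : a ^ 2 ≤ α ^ 2 := by
    rw [← sq_abs]; exact pow_le_pow_left₀ (abs_nonneg _) hap 2
  -- third-order Taylor remainder of the characteristic function
  have h1 : ‖sizeMean s.z u (fun δ => cexp ((θ * (δ * a) : ℝ) * I)
      - (1 + (θ * (δ * a)) • I - ((θ * (δ * a)) ^ 2) • (1 / 2 : ℂ)))‖ ≤ 4 * |θ| ^ 3 * α * D := by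
    refine (norm_sizeMean_le _ _ _).trans ((hf.sizeMean_le_of_quadratic hp (a := 0) (b := 0)
      (c := 2 * |θ| ^ 3 * (α * a ^ 2)) (by positivity) fun δ hδ => ?_).trans ?_)
    · have hx : |θ * (δ * a)| ≤ 1 := by
        rw [abs_mul, abs_mul]
        calc |θ| * (|δ| * |a|) ≤ |θ| * (2 * α) := by gcongr
          _ ≤ 1 := by linarith
      refine (norm_exp_sub_quadratic_le hx).trans ?_
      rw [abs_mul, abs_mul, mul_pow, mul_pow, zero_mul, zero_add, zero_add]
      have e1 : |δ| ^ 3 ≤ 2 * δ ^ 2 := by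
        rw [pow_succ, sq_abs, mul_comm]
        exact mul_le_mul_of_nonneg_right hδ (sq_nonneg _)
      have e2 : |a| ^ 3 ≤ α * a ^ 2 := by
        rw [pow_succ, sq_abs, mul_comm]
        exact mul_le_mul_of_nonneg_right hap (sq_nonneg _)
      calc |θ| ^ 3 * (|δ| ^ 3 * |a| ^ 3) ≤ |θ| ^ 3 * ((2 * δ ^ 2) * (α * a ^ 2)) := by gcongr
        _ = _ := by ring
    · rw [zero_add]
      calc 2 * |θ| ^ 3 * (α * a ^ 2) ≤ 2 * |θ| ^ 3 * (α * (2 * D)) := by gcongr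
        _ = _ := by ring
  -- second-order term
  have h2 : sizeMean s.z u
      (fun δ => (1 : ℂ) + (θ * (δ * a)) • I - ((θ * (δ * a)) ^ 2) • (1 / 2 : ℂ))
      = ((1 - θ ^ 2 * (a ^ 2 * (1 - s.z p ^ 2)) / 2 : ℝ) : ℂ) := by
    have e1 : sizeMean s.z u (fun δ => θ * (δ * a)) = 0 := by
      have := sizeMean_mul_left s.z u (θ * a) fun δ => δ
      rw [sizeMean_id, mul_zero] at this
      rw [← this]; congr 1; ext δ; ring
    have e2 : sizeMean s.z u (fun δ => (θ * (δ * a)) ^ 2) = θ ^ 2 * a ^ 2 * (1 - s.z p ^ 2) := by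
      rw [← hsz, ← sizeMean_mul_left]; congr 1; ext δ; ring
    rw [sizeMean_sub, sizeMean_add, sizeMean_const, sizeMean_smul_const, sizeMean_smul_const,
      e1, e2]
    simp
    ring
  have h3 : |(1 - θ ^ 2 * (a ^ 2 * (1 - s.z p ^ 2)) / 2) - (1 - θ ^ 2 * D / 2)|
      ≤ θ ^ 2 * (speedBound r κ k₀ + 2 * η ^ 2) * D := by
    have e : (1 - θ ^ 2 * (a ^ 2 * (1 - s.z p ^ 2)) / 2) - (1 - θ ^ 2 * D / 2)
        = -(θ ^ 2 / 2) * (a ^ 2 * (1 - s.z p ^ 2) - D) := by ring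
    rw [e, abs_mul, abs_neg, abs_of_nonneg (by positivity)]
    calc θ ^ 2 / 2 * |a ^ 2 * (1 - s.z p ^ 2) - D|
        ≤ θ ^ 2 * ((speedBound r κ k₀ + 2 * η ^ 2) * D) := by
          gcongr; linarith [sq_nonneg θ]
      _ = _ := by ring
  have hθα : θ ^ 2 * α ^ 2 ≤ 1 / 4 := by
    have : (2 * |θ| * α) ^ 2 ≤ 1 := pow_le_one₀ (by positivity) hθ
    rw [mul_pow, mul_pow, sq_abs] at this
    linarith
  have h4 : |(1 - θ ^ 2 * D / 2) - Real.exp (-(θ ^ 2 * D / 2))| ≤ θ ^ 4 * α ^ 2 * D := by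
    have hy0 : 0 ≤ θ ^ 2 * D / 2 := by positivity
    have hDα : θ ^ 2 * D ≤ θ ^ 2 * α ^ 2 :=
      mul_le_mul_of_nonneg_left (hDa.trans haα) (sq_nonneg θ)
    have := Real.abs_exp_sub_one_sub_id_le (x := -(θ ^ 2 * D / 2))
      (by rw [abs_neg, abs_of_nonneg hy0]; linarith)
    rw [abs_sub_comm]
    calc |Real.exp (-(θ ^ 2 * D / 2)) - (1 - θ ^ 2 * D / 2)|
        = |Real.exp (-(θ ^ 2 * D / 2)) - 1 - -(θ ^ 2 * D / 2)| := by congr 1; ring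
      _ ≤ (-(θ ^ 2 * D / 2)) ^ 2 := this
      _ = (θ ^ 2 / 4) * (θ ^ 2 * D) * D := by ring
      _ ≤ (θ ^ 2) * (θ ^ 2 * α ^ 2) * D := by
          gcongr
          linarith [sq_nonneg θ]
      _ = _ := by ring
  rw [sizeMean_sub, h2] at h1
  calc _ ≤ ‖sizeMean s.z u (fun δ => cexp ((θ * (δ * a) : ℝ) * I))
          - ((1 - θ ^ 2 * (a ^ 2 * (1 - s.z p ^ 2)) / 2 : ℝ) : ℂ)‖
        + ‖((1 - θ ^ 2 * (a ^ 2 * (1 - s.z p ^ 2)) / 2 : ℝ) : ℂ) - ((1 - θ ^ 2 * D / 2 : ℝ) : ℂ)‖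
        + ‖((1 - θ ^ 2 * D / 2 : ℝ) : ℂ) - (Real.exp (-(θ ^ 2 * D / 2)) : ℂ)‖ :=
        (norm_sub_le_norm_sub_add_norm_sub _ _ _).trans
          (by gcongr; exact norm_sub_le_norm_sub_add_norm_sub _ _ _)
    _ ≤ 4 * |θ| ^ 3 * α * D + θ ^ 2 * (speedBound r κ k₀ + 2 * η ^ 2) * D
        + θ ^ 4 * α ^ 2 * D := by
        rw [← ofReal_sub, ← ofReal_sub, norm_real, norm_real]
        exact add_le_add (add_le_add h1 h3) h4
    _ = _ := by ring

open Complex in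
/-- The comparison principle for `exp (i θ ⟨z, v⟩ - θ² R(A) / 2)`; for a unit vector `v` with
`vᵀ Y = 0` its initial value is `exp (-θ² / 2)`. -/
theorem WalkBounds.charFun_estimate (h : WalkBounds B Y c r κ η k₀) (hk : k₀ ≤ n)
    (hv : v ⬝ᵥ v = 1) (hvY : v ᵥ* Y = 0) {θ ν α : ℝ} (hν : 0 < ν)
    (hα : α = ‖v‖ + √(speedBound r κ k₀)) (hθ : 2 * |θ| * α ≤ 1) :
    ‖(stepMean B)^[n] (fun s => cexp ((θ * (s.z ⬝ᵥ v) : ℝ) * I)) (initState n)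
        - (Real.exp (-(θ ^ 2 / 2)) : ℂ)‖
      ≤ 2 * badPotential Y r κ η k₀ (initState n)
        + (4 * |θ| ^ 3 * α + θ ^ 2 * (speedBound r κ k₀ + 2 * η ^ 2) + θ ^ 4 * α ^ 2) + ν
        + (θ ^ 2 * (1 + r ^ 2) / (4 * ν) + θ ^ 2 / 2) * (k₀ / n) := by
  have hα0 : 0 ≤ α := by rw [hα]; positivity
  have hnv : euclNorm v = 1 := by
    rw [← Real.sqrt_sq (euclNorm_nonneg v), euclNorm_sq, hv, Real.sqrt_one]
  set f : State n → ℂ := fun s => cexp ((θ * (s.z ⬝ᵥ v) : ℝ) * I) with hfdef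
  set g : State n → ℂ := fun s =>
    f s * (Real.exp (-(θ ^ 2 * residualVar Y v s.active / 2)) : ℂ) with hgdef
  have hf1 : ∀ s, ‖f s‖ = 1 := fun s => norm_exp_ofReal_mul_I _
  have hexp : ∀ A, Real.exp (-(θ ^ 2 * residualVar Y v A / 2)) ≤ 1 := fun A => by
    rw [Real.exp_le_one_iff]
    have := residualVar_nonneg Y v A
    have : 0 ≤ θ ^ 2 * residualVar Y v A / 2 := by positivity
    linarith
  have hg1 : ∀ s, ‖g s‖ ≤ 1 := fun s => by
    rw [hgdef]
    simp only
    rw [norm_mul, hf1, one_mul, norm_real, Real.norm_of_nonneg (Real.exp_pos _).le]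
    exact hexp _
  have hTf : ∀ k s, ‖(stepMean B)^[k] f s‖ ≤ 1 := fun k s => by
    refine (norm_iterate_stepMean_le B k f s).trans_eq ?_
    simp only [hf1]
    exact iterate_stepMean_const B k 1 s
  have key := h.norm_iterate_sub_le (v := v) (f := f) (g := g)
    (C₁ := 2) (C₂ := θ ^ 2 * (1 + r ^ 2) / (4 * ν) + θ ^ 2 / 2)
    (ω := 4 * |θ| ^ 3 * α + θ ^ 2 * (speedBound r κ k₀ + 2 * η ^ 2) + θ ^ 4 * α ^ 2) (ν := ν)
    (by positivity) (by positivity)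
    (by have := h.speedBound_nonneg; positivity) hν.le
    (fun s _ _ => (norm_sub_le _ _).trans (by linarith [hTf s.active.card s, hg1 s]))
    (fun s hs hg hk => by
      have hf := h.isFree hs hg hk.le
      have hkA : (0 : ℝ) < s.active.card := by exact_mod_cast hf.nonempty.card_pos
      have hαp : ∀ p ∈ s.active, |v ⬝ᵥ stepDirection B s.active p| ≤ α := fun p hp => by
        have := h.abs_dotProduct_stepDirection_le hg hk.le hp v
        rwa [hnv, one_mul, ← hα] at this
      have e1 : stepMean B g s - g s = (s.active.card : ℝ)⁻¹ • ∑ p ∈ s.active,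
          (sizeMean s.z (stepDirection B s.active p) (fun δ => g (freeNext B s p δ)) - g s) := by
        rw [hf.stepMean_eq, Finset.sum_sub_distrib, smul_sub, Finset.sum_const,
          ← Nat.cast_smul_eq_nsmul ℝ, inv_smul_smul₀ hkA.ne']
      have e2 : ∀ p ∈ s.active,
          ‖sizeMean s.z (stepDirection B s.active p) (fun δ => g (freeNext B s p δ)) - g s‖
          ≤ (4 * |θ| ^ 3 * α + θ ^ 2 * (speedBound r κ k₀ + 2 * η ^ 2) + θ ^ 4 * α ^ 2)
            * (residualVar Y v s.active - residualVar Y v (s.active.erase p)) := by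
        intro p hp
        refine le_trans (le_of_eq_of_le ?_ (mul_le_of_le_one_left (norm_nonneg _)
          (hexp (s.active.erase p)))) (h.norm_charFun_step_le hs hg hk.le hp hαp hθ)
        have e3 : (fun δ => g (freeNext B s p δ)) = fun δ =>
            (f s * (Real.exp (-(θ ^ 2 * residualVar Y v (s.active.erase p) / 2)) : ℂ))
              * cexp ((θ * (δ * (v ⬝ᵥ stepDirection B s.active p)) : ℝ) * I) := by
          ext δ
          simp only [hgdef, hfdef, freeNext_dotProduct]
          have : (freeNext B s p δ).active = s.active.erase p := rfl
          rw [this, mul_add, ofReal_add, add_mul, Complex.exp_add]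
          ring
        have e4 : g s = (f s * (Real.exp (-(θ ^ 2 * residualVar Y v (s.active.erase p) / 2)) : ℂ))
            * (Real.exp (-(θ ^ 2 * (residualVar Y v s.active
              - residualVar Y v (s.active.erase p)) / 2)) : ℂ) := by
          rw [mul_assoc, ← ofReal_mul, ← Real.exp_add]
          simp only [hgdef]
          congr 3
          ring
        rw [e3, sizeMean_mul_left_complex, e4, ← mul_sub, norm_mul, norm_mul, hf1, one_mul,
          norm_real, Real.norm_of_nonneg (Real.exp_pos _).le]
      rw [e1, avg_sub_eq _ hf.nonempty, norm_smul, Real.norm_of_nonneg (by positivity),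
        mul_left_comm]
      refine mul_le_mul_of_nonneg_left ?_ (by positivity)
      rw [Finset.mul_sum]
      exact (norm_sum_le _ _).trans (Finset.sum_le_sum e2))
    (fun s hs _ => by
      set k := s.active.card
      have hR := residualVar_nonneg Y v s.active
      have hRV := residualVar_le_sum Y v s.active
      have e1 : ‖(stepMean B)^[k] f s - f s‖
          ≤ ν + θ ^ 2 * (1 + r ^ 2) / (4 * ν) * residualVar Y v s.active := by
        have e2 : (stepMean B)^[k] f s - f s = (stepMean B)^[k] (fun s' => f s' - f s) s := by
          rw [iterate_stepMean_sub, iterate_stepMean_const]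
        -- `|x| ≤ ν + x² / (4 ν)` turns the second-moment bound into a first-moment bound
        have e3 : ∀ s', ‖f s' - f s‖
            ≤ ν - (-(θ ^ 2 / (4 * ν))) * (s'.z ⬝ᵥ v - s.z ⬝ᵥ v) ^ 2 := by
          intro s'
          have e4 : ‖f s' - f s‖ ≤ |θ * (s'.z ⬝ᵥ v - s.z ⬝ᵥ v)| := by
            have e5 : f s' - f s
                = f s * (cexp (I * (θ * (s'.z ⬝ᵥ v - s.z ⬝ᵥ v) : ℝ)) - 1) := by
              simp only [hfdef]
              rw [mul_sub, mul_one, ← Complex.exp_add]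
              congr 2
              push_cast
              ring
            rw [e5, norm_mul, hf1, one_mul]
            exact Real.norm_exp_I_mul_ofReal_sub_one_le
          refine e4.trans ?_
          set x := θ * (s'.z ⬝ᵥ v - s.z ⬝ᵥ v) with hx
          have e6 : ν - (-(θ ^ 2 / (4 * ν))) * (s'.z ⬝ᵥ v - s.z ⬝ᵥ v) ^ 2
              = ν + x ^ 2 / (4 * ν) := by rw [hx]; ring
          rw [e6, ← sub_nonneg]
          have e7 : ν + x ^ 2 / (4 * ν) - |x| = (2 * ν - |x|) ^ 2 / (4 * ν) := by
            field_simp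
            rw [← sq_abs x]
            ring
          rw [e7]
          positivity
        rw [e2]
        refine (norm_iterate_stepMean_le B k _ s).trans
          ((iterate_stepMean_mono B k e3 s).trans ?_)
        rw [iterate_stepMean_sub, iterate_stepMean_const]
        have e8 : ∀ (j : ℕ) (a : ℝ) (F : State n → ℝ) (s : State n),
            (stepMean B)^[j] (fun s => a * F s) s = a * (stepMean B)^[j] F s := by
          intro j a F
          induction j with
          | zero => intro s; rfl
          | succ j ih =>
            intro s
            rw [Function.iterate_succ_apply', Function.iterate_succ_apply', funext ih,
              stepMean_mul_left]
        rw [e8]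
        have e9 := h.iterate_sq_le (v := v) hs (s.z ⬝ᵥ v) k
        rw [sub_self, zero_pow two_ne_zero, zero_add] at e9
        have e10 := mul_le_mul_of_nonneg_left e9 (by positivity : 0 ≤ θ ^ 2 / (4 * ν))
        have e11 : θ ^ 2 / (4 * ν) * ((1 + r ^ 2) * residualVar Y v s.active)
            = θ ^ 2 * (1 + r ^ 2) / (4 * ν) * residualVar Y v s.active := by ring
        linarith
      have e12 : ‖f s - g s‖ ≤ θ ^ 2 / 2 * residualVar Y v s.active := by
        have e13 : f s - g s
            = f s * ((1 - Real.exp (-(θ ^ 2 * residualVar Y v s.active / 2)) : ℝ) : ℂ) := by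
          simp only [hgdef]; push_cast; ring
        rw [e13, norm_mul, hf1, one_mul, norm_real,
          Real.norm_of_nonneg (sub_nonneg.2 (hexp _))]
        linarith [Real.add_one_le_exp (-(θ ^ 2 * residualVar Y v s.active / 2))]
      refine (norm_sub_le_norm_sub_add_norm_sub _ (f s) _).trans ((add_le_add e1 e12).trans ?_)
      have e14 : 0 ≤ θ ^ 2 * (1 + r ^ 2) / (4 * ν) + θ ^ 2 / 2 := by positivity
      linarith [mul_le_mul_of_nonneg_left hRV e14])
    hk (initState_isRegular n) (by simp [initState])
  have e3 : residualVar Y v (initState n).active = 1 := by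
    rw [← hv]; exact residualVar_univ Y hvY
  have e4 : ∑ i ∈ (initState n).active, v i ^ 2 = 1 := by
    rw [← hv]; simp [initState, dotProduct, sq]
  have e5 : (initState n).active.card = n := by simp [initState]
  have e6 : f (initState n) = 1 := by simp [hfdef, initState]
  have e7 : g (initState n) = (Real.exp (-(θ ^ 2 / 2)) : ℂ) := by
    simp only [hgdef]
    rw [e6, e3, mul_one, one_mul]
  rw [e3, e4, e5, e7, mul_one, mul_one] at key
  exact key

end Estimates

/-! ### The walk with covariates `X` -/

section Covariates

variable {n d : ℕ} {φ : ℝ} {X : Matrix (Fin n) (Fin d) ℝ}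

theorem scaledCov_row (φ : ℝ) (X : Matrix (Fin n) (Fin d) ℝ) (i : Fin n) :
    scaledCov φ X i = ((maxRowNorm X)⁻¹ * (√(1 - φ) / √φ)) • X i := rfl

theorem euclNorm_augMatrix_sq (hφ0 : 0 < φ) (w : Fin n → ℝ) :
    euclNorm (augMatrix φ X *ᵥ w) ^ 2 = φ * covForm (scaledCov φ X) w w := by
  have h1 : √φ ≠ 0 := (Real.sqrt_pos.2 hφ0).ne'
  have h2 : √φ * √φ = φ := Real.mul_self_sqrt hφ0.le
  rw [euclNorm_sq, augMatrix, Matrix.fromRows_mulVec, dotProduct, Fintype.sum_sum_type]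
  simp only [Sum.elim_inl, Sum.elim_inr, Matrix.smul_mulVec, Matrix.one_mulVec, Pi.smul_apply,
    smul_eq_mul, Matrix.mulVec_transpose]
  rw [covForm, mul_add, scaledCov, Matrix.vecMul_smul, dotProduct_smul, smul_dotProduct]
  congr 1
  · rw [dotProduct, Finset.mul_sum]
    refine Finset.sum_congr rfl fun i _ => ?_
    linear_combination (w i * w i) * h2
  · simp only [dotProduct, smul_eq_mul, Finset.mul_sum]
    refine Finset.sum_congr rfl fun i _ => ?_
    generalize (w ᵥ* X) i = x
    field_simp
    linear_combination (x ^ 2 * √(1 - φ) ^ 2 * (maxRowNorm X)⁻¹ ^ 2) * h2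

theorem maxRowNorm_nonneg (X : Matrix (Fin n) (Fin d) ℝ) : 0 ≤ maxRowNorm X :=
  Real.iSup_nonneg fun _ => euclNorm_nonneg _

theorem euclNorm_row_le (X : Matrix (Fin n) (Fin d) ℝ) (i : Fin n) :
    euclNorm (X i) ≤ maxRowNorm X :=
  le_ciSup (f := fun i => euclNorm (X i)) (Set.finite_range _).bddAbove i

theorem scaledCov_row_le {c : ℝ} (hc : 0 < c) (hcφ : c ≤ φ) (hφ1 : φ < 1) (i : Fin n) :
    scaledCov φ X i ⬝ᵥ scaledCov φ X i ≤ √(1 / c) ^ 2 := by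
  have hφ0 : 0 < φ := hc.trans_le hcφ
  rw [Real.sq_sqrt (by positivity), scaledCov_row, smul_dotProduct, dotProduct_smul,
    ← euclNorm_sq, smul_eq_mul, smul_eq_mul]
  have h1 : (maxRowNorm X)⁻¹ * euclNorm (X i) ≤ 1 := by
    rw [inv_mul_eq_div]
    exact div_le_one_of_le₀ (euclNorm_row_le X i) (maxRowNorm_nonneg X)
  have h0 : 0 ≤ (maxRowNorm X)⁻¹ * euclNorm (X i) :=
    mul_nonneg (inv_nonneg.2 (maxRowNorm_nonneg X)) (euclNorm_nonneg _)
  have h2 : (√(1 - φ) / √φ) ^ 2 ≤ 1 / c := by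
    rw [div_pow, Real.sq_sqrt (by linarith), Real.sq_sqrt hφ0.le]
    exact div_le_div₀ zero_le_one (by linarith) hc hcφ
  calc _ = ((maxRowNorm X)⁻¹ * euclNorm (X i)) ^ 2 * (√(1 - φ) / √φ) ^ 2 := by ring
    _ ≤ 1 * (1 / c) := mul_le_mul (pow_le_one₀ h0 h1) h2 (sq_nonneg _) zero_le_one
    _ = 1 / c := one_mul _

theorem injective_mulVec_of_rank_eq (h : X.rank = d) : Function.Injective X.mulVec := by
  rw [Matrix.mulVec_injective_iff, linearIndependent_iff_card_eq_finrank_span, Fintype.card_fin]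
  have h' := X.rank_eq_finrank_span_cols
  rw [h] at h'
  exact h'

theorem maxRowNorm_pos (hd : 1 ≤ d) (h : X.rank = d) : 0 < maxRowNorm X := by
  refine lt_of_le_of_ne (maxRowNorm_nonneg X) fun h0 => ?_
  have hX : X = 0 := by
    ext i j
    have h1 : euclNorm (X i) = 0 :=
      le_antisymm ((euclNorm_row_le X i).trans_eq h0.symm) (euclNorm_nonneg _)
    have h2 : X i = 0 := by
      rw [← dotProduct_self_eq_zero, ← euclNorm_sq, h1]; norm_num
    simp [h2]
  rw [hX, Matrix.rank_zero] at h
  omega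

theorem injective_mulVec_scaledCov (hd : 1 ≤ d) (h : X.rank = d) (hφ0 : 0 < φ) (hφ1 : φ < 1) :
    Function.Injective (scaledCov φ X).mulVec := by
  have hs : (maxRowNorm X)⁻¹ * (√(1 - φ) / √φ) ≠ 0 := by
    have h1 := maxRowNorm_pos hd h
    have h2 : 0 < √(1 - φ) := Real.sqrt_pos.2 (by linarith)
    have h3 : 0 < √φ := Real.sqrt_pos.2 hφ0
    positivity
  intro x y hxy
  simp only [scaledCov, Matrix.smul_mulVec] at hxy
  exact injective_mulVec_of_rank_eq h (smul_right_injective _ hs hxy)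

section LambdaMin

variable {M : Matrix (Fin d) (Fin d) ℝ}

theorem lambdaMin_mul_le (hM : M.IsHermitian) (x : Fin d → ℝ) :
    lambdaMin M * (x ⬝ᵥ x) ≤ x ⬝ᵥ (M *ᵥ x) := by
  have hH : (M - algebraMap ℝ _ (lambdaMin M)).IsHermitian := by
    refine hM.sub ?_
    rw [Matrix.algebraMap_eq_diagonal]
    exact Matrix.isHermitian_diagonal_of_self_adjoint _ (by ext; simp)
  have hP : (M - algebraMap ℝ _ (lambdaMin M)).PosSemidef := by
    rw [hH.posSemidef_iff_eigenvalues_nonneg]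
    intro i
    have h1 := hH.eigenvalues_mem_spectrum_real i
    have h2 : hH.eigenvalues i + lambdaMin M ∈ spectrum ℝ M := by
      rw [spectrum.add_mem_iff, neg_add_eq_sub]
      exact h1
    have h3 := csInf_le (Matrix.finite_real_spectrum (A := M)).bddBelow h2
    have h4 : sInf (spectrum ℝ M) = lambdaMin M := rfl
    simp only [Pi.zero_apply]
    linarith
  have h5 := hP.dotProduct_mulVec_nonneg x
  rw [Matrix.sub_mulVec, Algebra.algebraMap_eq_smul_one, Matrix.smul_mulVec, Matrix.one_mulVec,
    dotProduct_sub, dotProduct_smul] at h5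
  simp only [star_trivial, smul_eq_mul] at h5
  linarith

theorem lambdaMin_pos (hd : 1 ≤ d) (hM : M.PosDef) : 0 < lambdaMin M := by
  have hne : (spectrum ℝ M).Nonempty :=
    ⟨_, hM.1.eigenvalues_mem_spectrum_real ⟨0, hd⟩⟩
  have h1 := hne.csInf_mem (Matrix.finite_real_spectrum (A := M))
  rw [hM.1.spectrum_real_eq_range_eigenvalues] at h1
  obtain ⟨i, hi⟩ := h1
  have h2 := hM.eigenvalues_pos i
  rw [hi, ← hM.1.spectrum_real_eq_range_eigenvalues] at h2
  exact h2

end LambdaMin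

theorem sum_sq_eq_dotProduct_mulVec (Y : Matrix (Fin n) (Fin d) ℝ) (x : Fin d → ℝ) :
    ∑ i, (Y i ⬝ᵥ x) ^ 2 = x ⬝ᵥ ((Yᵀ * Y) *ᵥ x) := by
  rw [← Matrix.mulVec_mulVec, Matrix.dotProduct_mulVec, Matrix.vecMul_transpose]
  simp only [dotProduct, sq, Matrix.mulVec]

theorem lambdaMin_scaledCov_pos (hd : 1 ≤ d) (h : X.rank = d) (hφ0 : 0 < φ) (hφ1 : φ < 1) :
    0 < lambdaMin ((scaledCov φ X)ᵀ * scaledCov φ X) :=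
  lambdaMin_pos hd (Matrix.PosDef.conjTranspose_mul_self _
    (injective_mulVec_scaledCov hd h hφ0 hφ1))

theorem kappa_pos (hd : 1 ≤ d) (hdn : d ≤ n) (h : X.rank = d) (hφ0 : 0 < φ) (hφ1 : φ < 1) :
    0 < kappa φ X :=
  div_pos (by exact_mod_cast hd.trans hdn) (lambdaMin_scaledCov_pos hd h hφ0 hφ1)

theorem frame_kappa (hd : 1 ≤ d) (hdn : d ≤ n) (x : Fin d → ℝ) :
    n / kappa φ X * (x ⬝ᵥ x) ≤ ∑ i, (scaledCov φ X i ⬝ᵥ x) ^ 2 := by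
  have hn : (n : ℝ) ≠ 0 := by exact_mod_cast (by omega : n ≠ 0)
  rw [kappa, div_div_cancel₀ hn, sum_sq_eq_dotProduct_mulVec]
  exact lambdaMin_mul_le (Matrix.isHermitian_conjTranspose_mul_self (scaledCov φ X)) x

/-- Bounded rows of `Y` keep `κ` away from `0`: test the frame bound on a coordinate vector. -/
theorem le_kappa {c : ℝ} (hc : 0 < c) (hcφ : c ≤ φ) (hφ1 : φ < 1) (hd : 1 ≤ d) (hdn : d ≤ n)
    (h : X.rank = d) : c ≤ kappa φ X := by
  have hκ := kappa_pos hd hdn h (hc.trans_le hcφ) hφ1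
  have hn : (0 : ℝ) < n := by exact_mod_cast hd.trans hdn
  have h1 := frame_kappa (φ := φ) (X := X) hd hdn (Pi.single ⟨0, hd⟩ 1)
  have h2 : ∑ i, (scaledCov φ X i ⬝ᵥ Pi.single ⟨0, hd⟩ 1) ^ 2 ≤ n * (1 / c) := by
    have : ∀ i ∈ Finset.univ, (scaledCov φ X i ⬝ᵥ Pi.single ⟨0, hd⟩ 1) ^ 2 ≤ 1 / c := by
      intro i _
      refine (dotProduct_sq_le _ _).trans ?_
      have := scaledCov_row_le (X := X) hc hcφ hφ1 i
      rw [Real.sq_sqrt (by positivity)] at this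
      simpa using this
    simpa using Finset.sum_le_sum this
  have h3 : n / kappa φ X ≤ n * (1 / c) := by simpa using h1.trans h2
  rw [mul_one_div, div_le_div_iff_of_pos_left hn hκ hc] at h3
  exact h3

theorem walkBounds_augMatrix {c η : ℝ} {k₀ : ℕ} (hc : 0 < c) (hcφ : c ≤ φ) (hφ1 : φ < 1)
    (hd : 1 ≤ d) (hdn : d ≤ n) (h : X.rank = d) (hη : 0 < η) (hη2 : η ≤ 1 / 2) (hk : 0 < k₀)
    (hkκ : 32 * √(1 / c) ^ 2 * kappa φ X ≤ k₀) :
    WalkBounds (augMatrix φ X) (scaledCov φ X) φ (√(1 / c)) (kappa φ X) η k₀ where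
  c_pos := hc.trans_le hcφ
  norm_sq := euclNorm_augMatrix_sq (hc.trans_le hcφ)
  r_nonneg := Real.sqrt_nonneg _
  row_le := scaledCov_row_le hc hcφ hφ1
  κ_pos := kappa_pos hd hdn h (hc.trans_le hcφ) hφ1
  frame := frame_kappa hd hdn
  η_pos := hη
  η_le := hη2
  k₀_pos := hk
  k₀_large := hkκ

end Covariates

section DesignMoments

variable {n d : ℕ} {φ : ℝ} {X : Matrix (Fin n) (Fin d) ℝ}

theorem continuous_dotProduct_right (v : Fin n → ℝ) : Continuous fun z : Fin n → ℝ => z ⬝ᵥ v := by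
  unfold dotProduct; fun_prop

theorem designVar_eq (φ : ℝ) (X : Matrix (Fin n) (Fin d) ℝ) (v : Fin n → ℝ) :
    designVar φ X v
      = (stepMean (augMatrix φ X))^[n] (fun s => (s.z ⬝ᵥ v) ^ 2) (initState n) := by
  have hcont := continuous_dotProduct_right v
  have h0 : ∫ z, z ⬝ᵥ v ∂designLaw φ X = 0 := by
    rw [integral_designLaw φ X hcont.aestronglyMeasurable, iterate_stepMean_dotProduct]
    simp [initState]
  rw [designVar, variance_of_integral_eq_zero hcont.aemeasurable h0,
    integral_designLaw φ X (f := fun z => (z ⬝ᵥ v) ^ 2) (hcont.pow 2).aestronglyMeasurable]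

theorem designVar_smul (φ : ℝ) (X : Matrix (Fin n) (Fin d) ℝ) (a : ℝ) (v : Fin n → ℝ) :
    designVar φ X (a • v) = a ^ 2 * designVar φ X v := by
  simp only [designVar, dotProduct_smul, smul_eq_mul]
  exact variance_const_mul a _ _

open Complex in
theorem charFun_map_design (φ : ℝ) (X : Matrix (Fin n) (Fin d) ℝ) (v : Fin n → ℝ) (σ t : ℝ) :
    charFun ((designLaw φ X).map fun z => (z ⬝ᵥ v) / σ) t
      = (stepMean (augMatrix φ X))^[n]
          (fun s => cexp ((t / σ * (s.z ⬝ᵥ v) : ℝ) * I)) (initState n) := by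
  have hcont := continuous_dotProduct_right v
  rw [charFun_apply_real, integral_map (by fun_prop) (by fun_prop),
    ← integral_designLaw φ X (f := fun z => cexp ((t / σ * (z ⬝ᵥ v) : ℝ) * I))
      (by fun_prop)]
  refine integral_congr_ae (ae_of_all _ fun z => ?_)
  simp only
  congr 2
  push_cast
  ring

end DesignMoments

/-! ### Asymptotics -/

section Asymptotics

/-- A positive constant at most `1 / 2` that makes `K x` smaller than a given tolerance. -/
theorem exists_small {K e : ℝ} (hK : 0 ≤ K) (he : 0 < e) :
    ∃ x : ℝ, 0 < x ∧ x ≤ 1 / 2 ∧ K * x ≤ e := by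
  refine ⟨min (1 / 2) (e / (K + 1)), by positivity, min_le_left _ _, ?_⟩
  calc K * min (1 / 2) (e / (K + 1)) ≤ (K + 1) * (e / (K + 1)) := by
        gcongr
        · linarith
        · exact min_le_right _ _
    _ = e := by field_simp

variable {κ : ℕ → ℝ} {c ε : ℝ}

theorem le_ceil_mul (ε : ℝ) (n : ℕ) : ε * n ≤ (⌈ε * n⌉₊ : ℝ) := Nat.le_ceil _

theorem ceil_mul_le_self (hε1 : ε ≤ 1) (n : ℕ) : ⌈ε * n⌉₊ ≤ n :=
  Nat.ceil_le.2 (mul_le_of_le_one_left (Nat.cast_nonneg n) hε1)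

theorem eventually_ceil_div_le (hε : 0 < ε) : ∀ᶠ n : ℕ in atTop, (⌈ε * n⌉₊ : ℝ) / n ≤ 2 * ε := by
  filter_upwards [eventually_gt_atTop 0,
    tendsto_natCast_atTop_atTop.eventually_ge_atTop (1 / ε)] with n hn h1
  have hn' : (0 : ℝ) < n := by exact_mod_cast hn
  rw [div_le_iff₀ hn']
  have h2 := (Nat.ceil_lt_add_one (a := ε * n) (by positivity)).le
  rw [div_le_iff₀ hε] at h1
  linarith

theorem speedBound_le_mul (hc : 0 < c) (hε : 0 < ε) (r : ℝ) {n : ℕ} (hn : 0 < n) {κ : ℝ}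
    (hκ : c ≤ κ) :
    speedBound r κ ⌈ε * n⌉₊ ≤ 4 * r ^ 2 / (ε * c) * (κ ^ 2 / √n) := by
  have hn1 : (1 : ℝ) ≤ n := by exact_mod_cast hn
  have hs : √(n : ℝ) ≤ n := Real.sqrt_le_left (by linarith) |>.2 (by nlinarith)
  have hs0 : 0 < √(n : ℝ) := Real.sqrt_pos.2 (by linarith)
  have hκ0 : 0 < κ := hc.trans_le hκ
  calc speedBound r κ ⌈ε * n⌉₊ ≤ 4 * r ^ 2 * κ / (ε * √n) := by
        unfold speedBound
        exact div_le_div_of_nonneg_left (by positivity) (by positivity)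
          ((mul_le_mul_of_nonneg_left hs hε.le).trans (le_ceil_mul ε n))
    _ = 4 * r ^ 2 / (ε * c) * ((c * κ) / √n) := by field_simp
    _ ≤ 4 * r ^ 2 / (ε * c) * (κ ^ 2 / √n) := by
        gcongr
        nlinarith

theorem tendsto_speedBound (hc : 0 < c) (hε : 0 < ε) (r : ℝ)
    (hκ : ∀ᶠ n in atTop, c ≤ κ n)
    (ht : Tendsto (fun n => κ n ^ 2 / √(n : ℝ)) atTop (𝓝 0)) :
    Tendsto (fun n => speedBound r (κ n) ⌈ε * n⌉₊) atTop (𝓝 0) := by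
  have h1 := ht.const_mul (4 * r ^ 2 / (ε * c))
  rw [mul_zero] at h1
  refine squeeze_zero' ?_ ?_ h1
  · filter_upwards [hκ] with n hn
    have := hc.trans_le hn
    unfold speedBound; positivity
  · filter_upwards [hκ, eventually_gt_atTop 0] with n h2 h3
    exact speedBound_le_mul hc hε r h3 h2

/-- With `k₀ = ⌈ε n⌉`, the initial potential is of order `κ² / n + κ⁴ / n`. -/
theorem tendsto_badPotential {d : ℕ → ℕ} (Y : ∀ n, Matrix (Fin n) (Fin (d n)) ℝ)
    (hc : 0 < c) (hε : 0 < ε) (r η : ℝ) (hκ : ∀ᶠ n in atTop, c ≤ κ n)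
    (ht : Tendsto (fun n => κ n ^ 2 / √(n : ℝ)) atTop (𝓝 0)) :
    Tendsto (fun n => badPotential (Y n) r (κ n) η ⌈ε * n⌉₊ (initState n)) atTop (𝓝 0) := by
  have h1 : Tendsto (fun n : ℕ => 4 * r ^ 4 / ε ^ 2 * (κ n ^ 2 / √(n : ℝ))
      + (η ^ 4)⁻¹ * (6400 * r ^ 8 / ε ^ 4 * (κ n ^ 2 / √(n : ℝ)) ^ 2)) atTop (𝓝 0) := by
    have := (ht.const_mul (4 * r ^ 4 / ε ^ 2)).add
      (((ht.pow 2).const_mul (6400 * r ^ 8 / ε ^ 4)).const_mul (η ^ 4)⁻¹)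
    simpa using this
  have h4 : 0 ≤ (η ^ 4)⁻¹ := inv_nonneg.2 (by positivity)
  refine squeeze_zero' ?_ ?_ h1
  · filter_upwards with n
    rw [badPotential_initState]
    positivity
  · filter_upwards [hκ, eventually_gt_atTop 0] with n h2 h3
    have hκ0 : 0 < κ n := hc.trans_le h2
    have hn1 : (1 : ℝ) ≤ n := by exact_mod_cast h3
    have hn0 : (0 : ℝ) < n := by linarith
    have hs : √(n : ℝ) ≤ n := Real.sqrt_le_left (by linarith) |>.2 (by nlinarith)
    have hs0 : 0 < √(n : ℝ) := Real.sqrt_pos.2 hn0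
    have hs2 : √(n : ℝ) ^ 2 = n := Real.sq_sqrt hn0.le
    have hk := le_ceil_mul ε n
    have hεn : 0 < ε * n := by positivity
    rw [badPotential_initState]
    refine add_le_add ?_ (mul_le_mul_of_nonneg_left ?_ h4)
    · calc 4 * κ n ^ 2 * (r ^ 4 / (⌈ε * n⌉₊ : ℝ) ^ 2 * n)
          ≤ 4 * κ n ^ 2 * (r ^ 4 / (ε * n) ^ 2 * n) := by gcongr
        _ = 4 * r ^ 4 / ε ^ 2 * (κ n ^ 2 / n) := by field_simp
        _ ≤ 4 * r ^ 4 / ε ^ 2 * (κ n ^ 2 / √(n : ℝ)) := by gcongr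
    · have h5 : speedBound r (κ n) ⌈ε * n⌉₊ ≤ 4 * r ^ 2 * κ n / (ε * n) := by
        unfold speedBound; gcongr
      have h6 : 0 ≤ speedBound r (κ n) ⌈ε * n⌉₊ := by unfold speedBound; positivity
      calc n * (5 * n * speedBound r (κ n) ⌈ε * n⌉₊ ^ 2) ^ 2
          ≤ n * (5 * n * (4 * r ^ 2 * κ n / (ε * n)) ^ 2) ^ 2 := by gcongr
        _ = 6400 * r ^ 8 / ε ^ 4 * (κ n ^ 4 / n) := by field_simp; ring
        _ = 6400 * r ^ 8 / ε ^ 4 * (κ n ^ 2 / √(n : ℝ)) ^ 2 := by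
            rw [div_pow, hs2, ← pow_mul]

theorem eventually_k₀_large (hc : 0 < c) (hε : 0 < ε) (r : ℝ) (hκ : ∀ᶠ n in atTop, c ≤ κ n)
    (ht : Tendsto (fun n => κ n ^ 2 / √(n : ℝ)) atTop (𝓝 0)) :
    ∀ᶠ n : ℕ in atTop, 0 < ⌈ε * n⌉₊ ∧ 32 * r ^ 2 * κ n ≤ (⌈ε * n⌉₊ : ℝ) := by
  filter_upwards [(tendsto_speedBound hc hε r hκ ht).eventually_le_const
    (by norm_num : (0 : ℝ) < 1 / 8), eventually_gt_atTop 0] with n h1 h2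
  have hk : 0 < ⌈ε * n⌉₊ := Nat.ceil_pos.2 (by positivity)
  have hk' : (0 : ℝ) < (⌈ε * n⌉₊ : ℝ) := by exact_mod_cast hk
  refine ⟨hk, ?_⟩
  rw [speedBound, div_le_iff₀ hk'] at h1
  linarith

variable {d : ℕ → ℕ} {m : ℕ → Type*} [∀ n, Fintype (m n)] {B : ∀ n, Matrix (m n) (Fin n) ℝ}
  {Y : ∀ n, Matrix (Fin n) (Fin (d n)) ℝ} {b : ℕ → ℝ} {r : ℝ} {w : ∀ n, Fin n → ℝ}

theorem tendsto_variance (hc : 0 < c) (hκ : ∀ᶠ n in atTop, c ≤ κ n)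
    (ht : Tendsto (fun n => κ n ^ 2 / √(n : ℝ)) atTop (𝓝 0))
    (hW : ∀ᶠ n in atTop, ∀ η : ℝ, 0 < η → η ≤ 1 / 2 → ∀ k₀ : ℕ, 0 < k₀ →
      32 * r ^ 2 * κ n ≤ k₀ → WalkBounds (B n) (Y n) (b n) r (κ n) η k₀)
    (hw : ∀ᶠ n in atTop, w n ⬝ᵥ w n = 1) (hwY : ∀ᶠ n in atTop, w n ᵥ* Y n = 0) :
    Tendsto (fun n => (stepMean (B n))^[n] (fun s => (s.z ⬝ᵥ w n) ^ 2) (initState n))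
      atTop (𝓝 1) := by
  rw [Metric.tendsto_nhds]
  intro e he
  obtain ⟨η, hη0, hη, hηe⟩ := exists_small (K := 2) (by norm_num) (by positivity : 0 < e / 4)
  obtain ⟨ε, hε0, hε, hεe⟩ := exists_small (K := (1 + r ^ 2) * 2) (by positivity)
    (by positivity : 0 < e / 4)
  have hlim : Tendsto (fun n => (1 + r ^ 2) * badPotential (Y n) r (κ n) η ⌈ε * n⌉₊ (initState n)
      + (speedBound r (κ n) ⌈ε * n⌉₊ + 2 * η ^ 2) + (1 + r ^ 2) * (2 * ε)) atTop
      (𝓝 ((1 + r ^ 2) * 0 + (0 + 2 * η ^ 2) + (1 + r ^ 2) * (2 * ε))) :=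
    (((tendsto_badPotential Y hc hε0 r η hκ ht).const_mul _).add
      ((tendsto_speedBound hc hε0 r hκ ht).add_const _)).add_const _
  have hlt : (1 + r ^ 2) * 0 + (0 + 2 * η ^ 2) + (1 + r ^ 2) * (2 * ε) < e := by
    nlinarith
  filter_upwards [hlim.eventually_lt_const hlt, eventually_k₀_large hc hε0 r hκ ht, hW, hw, hwY,
    eventually_ceil_div_le hε0] with n h1 h2 h3 h4 h5 h6
  refine lt_of_le_of_lt ?_ h1
  rw [Real.dist_eq]
  refine ((h3 η hη0 hη _ h2.1 h2.2).variance_estimate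
    (ceil_mul_le_self (by linarith) n) h4 h5).trans ?_
  gcongr

open Complex in
/-- The frequency may vary with `n`, which absorbs the normalization by the standard deviation. -/
theorem tendsto_charFun (hc : 0 < c) (hκ : ∀ᶠ n in atTop, c ≤ κ n)
    (ht : Tendsto (fun n => κ n ^ 2 / √(n : ℝ)) atTop (𝓝 0))
    (hW : ∀ᶠ n in atTop, ∀ η : ℝ, 0 < η → η ≤ 1 / 2 → ∀ k₀ : ℕ, 0 < k₀ →
      32 * r ^ 2 * κ n ≤ k₀ → WalkBounds (B n) (Y n) (b n) r (κ n) η k₀)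
    (hw : ∀ᶠ n in atTop, w n ⬝ᵥ w n = 1) (hwY : ∀ᶠ n in atTop, w n ᵥ* Y n = 0)
    (hmax : Tendsto (fun n => ‖w n‖) atTop (𝓝 0)) {θ : ℕ → ℝ} {t : ℝ}
    (hθ : Tendsto θ atTop (𝓝 t)) :
    Tendsto (fun n => (stepMean (B n))^[n] (fun s => cexp ((θ n * (s.z ⬝ᵥ w n) : ℝ) * I))
      (initState n)) atTop (𝓝 (Real.exp (-(t ^ 2 / 2)) : ℂ)) := by
  have hgauss : Tendsto (fun n => (Real.exp (-(θ n ^ 2 / 2)) : ℂ)) atTop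
      (𝓝 (Real.exp (-(t ^ 2 / 2)) : ℂ)) := by
    have hc : Continuous fun x : ℝ => (Real.exp (-(x ^ 2 / 2)) : ℂ) := by fun_prop
    exact (hc.tendsto t).comp hθ
  suffices h : Tendsto (fun n => (stepMean (B n))^[n]
      (fun s => cexp ((θ n * (s.z ⬝ᵥ w n) : ℝ) * I)) (initState n)
        - (Real.exp (-(θ n ^ 2 / 2)) : ℂ)) atTop (𝓝 0) by
    simpa using h.add hgauss
  rw [Metric.tendsto_nhds]
  intro e he
  set T : ℝ := |t| + 1 with hT
  have hT0 : 0 < T := by positivity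
  set ν : ℝ := e / 4 with hν
  have hν0 : 0 < ν := by positivity
  obtain ⟨η, hη0, hη, hηe⟩ := exists_small (K := T ^ 2 * 2) (by positivity)
    (by positivity : 0 < e / 4)
  obtain ⟨ε, hε0, hε, hεe⟩ := exists_small
    (K := (T ^ 2 * (1 + r ^ 2) / (4 * ν) + T ^ 2 / 2) * 2) (by positivity)
    (by positivity : 0 < e / 4)
  have hsp := tendsto_speedBound hc hε0 r hκ ht
  set α : ℕ → ℝ := fun n => ‖w n‖ + √(speedBound r (κ n) ⌈ε * n⌉₊) with hα
  have hα0 : ∀ n, 0 ≤ α n := fun n => by simp only [hα]; positivity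
  have hαlim : Tendsto α atTop (𝓝 0) := by
    have h1 := hmax.add ((Real.continuous_sqrt.tendsto 0).comp hsp)
    simpa using h1
  have hlim : Tendsto (fun n => 2 * badPotential (Y n) r (κ n) η ⌈ε * n⌉₊ (initState n)
      + (4 * T ^ 3 * α n + T ^ 2 * (speedBound r (κ n) ⌈ε * n⌉₊ + 2 * η ^ 2)
        + T ^ 4 * α n ^ 2) + ν
      + (T ^ 2 * (1 + r ^ 2) / (4 * ν) + T ^ 2 / 2) * (2 * ε)) atTop
      (𝓝 (2 * 0 + (4 * T ^ 3 * 0 + T ^ 2 * (0 + 2 * η ^ 2) + T ^ 4 * 0 ^ 2) + ν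
        + (T ^ 2 * (1 + r ^ 2) / (4 * ν) + T ^ 2 / 2) * (2 * ε))) :=
    ((((tendsto_badPotential Y hc hε0 r η hκ ht).const_mul _).add
      (((hαlim.const_mul _).add ((hsp.add_const _).const_mul _)).add
        ((hαlim.pow 2).const_mul _))).add_const _).add_const _
  have hlt : 2 * 0 + (4 * T ^ 3 * 0 + T ^ 2 * (0 + 2 * η ^ 2) + T ^ 4 * 0 ^ 2) + ν
        + (T ^ 2 * (1 + r ^ 2) / (4 * ν) + T ^ 2 / 2) * (2 * ε) < e := by
    have h1 : T ^ 2 * (2 * η ^ 2) ≤ e / 4 := by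
      have : T ^ 2 * 2 * η ^ 2 ≤ T ^ 2 * 2 * η := by
        gcongr
        nlinarith
      linarith
    linarith
  have hαT : ∀ᶠ n in atTop, 2 * T * α n ≤ 1 := by
    have h1 := hαlim.const_mul (2 * T)
    rw [mul_zero] at h1
    exact h1.eventually_le_const one_pos
  have hθT : ∀ᶠ n in atTop, |θ n| ≤ T :=
    hθ.abs.eventually_le_const (by rw [hT]; linarith)
  filter_upwards [hlim.eventually_lt_const hlt, eventually_k₀_large hc hε0 r hκ ht, hW, hw, hwY,
    eventually_ceil_div_le hε0, hαT, hθT] with n h1 h2 h3 h4 h5 h6 h7 h8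
  refine lt_of_le_of_lt ?_ h1
  rw [dist_zero_right]
  have hB := h3 η hη0 hη _ h2.1 h2.2
  have hθα : 2 * |θ n| * α n ≤ 1 :=
    le_trans (by have := hα0 n; gcongr) h7
  refine (hB.charFun_estimate (ceil_mul_le_self (by linarith) n) h4 h5 hν0 rfl hθα).trans ?_
  have h9 : θ n ^ 2 ≤ T ^ 2 := by
    rw [← sq_abs]; exact pow_le_pow_left₀ (abs_nonneg _) h8 2
  have h10 : θ n ^ 4 ≤ T ^ 4 := by
    calc θ n ^ 4 = (θ n ^ 2) ^ 2 := by ring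
      _ ≤ (T ^ 2) ^ 2 := pow_le_pow_left₀ (sq_nonneg _) h9 2
      _ = T ^ 4 := by ring
  have h11 := hα0 n
  have h12 := hB.speedBound_nonneg
  gcongr

end Asymptotics

section Hypotheses

variable {n : ℕ} {v : Fin n → ℝ}

theorem euclNorm_pos (hv : v ≠ 0) : 0 < euclNorm v := by
  refine lt_of_le_of_ne (euclNorm_nonneg v) fun h => hv ?_
  rw [← dotProduct_self_eq_zero, ← euclNorm_sq, ← h]
  norm_num

/-- The ratio `‖v‖_∞ / ‖v‖` is at least `1 / √n`. -/
theorem one_le_norm_ratio_mul_sqrt (hv : v ≠ 0) : 1 ≤ ‖v‖ / euclNorm v * √(n : ℝ) := by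
  have h1 := euclNorm_pos hv
  rw [div_mul_eq_mul_div, le_div_iff₀ h1, one_mul]
  refine le_of_sq_le_sq ?_ (by positivity)
  rw [euclNorm_sq, mul_pow, Real.sq_sqrt (Nat.cast_nonneg n), mul_comm]
  have : ∀ i ∈ Finset.univ, v i * v i ≤ ‖v‖ ^ 2 := fun i _ => by
    have := norm_le_pi_norm v i
    rw [Real.norm_eq_abs] at this
    rw [← sq, ← sq_abs]
    exact pow_le_pow_left₀ (abs_nonneg _) this 2
  simpa [dotProduct] using Finset.sum_le_sum this

end Hypotheses

end

end GSW

open GSW in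
theorem theorem1p3
    (d : ℕ → ℕ) (X : ∀ n, Matrix (Fin n) (Fin (d n)) ℝ) (φ : ℕ → ℝ) (v : ∀ n, Fin n → ℝ)
    (hφ : ∃ c : ℝ, 0 < c ∧ ∀ᶠ n in atTop, c ≤ φ n ∧ φ n < 1)
    (hd : ∀ᶠ n in atTop, 1 ≤ d n ∧ d n ≤ n)
    (hX : ∀ᶠ n in atTop, (X n).rank = d n)
    (hv0 : ∀ᶠ n in atTop, v n ≠ 0)
    (hv : ∀ᶠ n in atTop, v n ᵥ* X n = 0)
    (hcond : Tendsto (fun n => √(d n : ℝ) * (‖v n‖ / GSW.euclNorm (v n)) *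
      GSW.kappa (φ n) (X n) ^ 2 * Real.log n) atTop (𝓝 0)) :
    TendstoInDistribution
      (fun n (z : Fin n → ℝ) => (z ⬝ᵥ v n) / √(GSW.designVar (φ n) (X n) (v n)))
      atTop (id : ℝ → ℝ) (fun n => GSW.designLaw (φ n) (X n)) (gaussianReal 0 1) ∧
    Tendsto (fun n => GSW.designVar (φ n) (X n) (v n) / GSW.euclNorm (v n) ^ 2)
      atTop (𝓝 1) := by
  obtain ⟨c, hc, hφ⟩ := hφ
  set κ : ℕ → ℝ := fun n => kappa (φ n) (X n) with hκdef
  have hκ : ∀ᶠ n in atTop, c ≤ κ n := by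
    filter_upwards [hφ, hd, hX] with n h1 h2 h3
    exact le_kappa hc h1.1 h1.2 h2.1 h2.2 h3
  have hlog : ∀ᶠ n : ℕ in atTop, 1 ≤ Real.log n :=
    (Real.tendsto_log_atTop.comp tendsto_natCast_atTop_atTop).eventually_ge_atTop 1
  -- the two consequences of the growth condition that the argument uses
  have hfac : ∀ᶠ n : ℕ in atTop, ‖v n‖ / euclNorm (v n) * κ n ^ 2
      ≤ √(d n : ℝ) * (‖v n‖ / euclNorm (v n)) * κ n ^ 2 * Real.log n := by
    filter_upwards [hd, hlog] with n h1 h2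
    have h3 : 1 ≤ √(d n : ℝ) := Real.one_le_sqrt.2 (by exact_mod_cast h1.1)
    have h4 : 0 ≤ ‖v n‖ / euclNorm (v n) * κ n ^ 2 :=
      mul_nonneg (div_nonneg (norm_nonneg _) (euclNorm_nonneg _)) (sq_nonneg _)
    calc ‖v n‖ / euclNorm (v n) * κ n ^ 2
        ≤ ‖v n‖ / euclNorm (v n) * κ n ^ 2 * (√(d n : ℝ) * Real.log n) :=
          le_mul_of_one_le_right h4 (one_le_mul_of_one_le_of_one_le h3 h2)
      _ = _ := by ring
  have hac : Tendsto (fun n => ‖v n‖ / euclNorm (v n) * κ n ^ 2) atTop (𝓝 0) :=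
    squeeze_zero' (Eventually.of_forall fun n =>
      mul_nonneg (div_nonneg (norm_nonneg _) (euclNorm_nonneg _)) (sq_nonneg _)) hfac hcond
  have ht : Tendsto (fun n => κ n ^ 2 / √(n : ℝ)) atTop (𝓝 0) := by
    refine squeeze_zero' (Eventually.of_forall fun n => by positivity) ?_ hac
    filter_upwards [hv0, eventually_gt_atTop 0] with n h1 h2
    have hs : 0 < √(n : ℝ) := Real.sqrt_pos.2 (by exact_mod_cast h2)
    rw [div_le_iff₀ hs]
    nlinarith [mul_le_mul_of_nonneg_right (one_le_norm_ratio_mul_sqrt h1) (sq_nonneg (κ n))]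
  have hratio : Tendsto (fun n => ‖v n‖ / euclNorm (v n)) atTop (𝓝 0) := by
    have h1 := hac.const_mul (c ^ 2)⁻¹
    rw [mul_zero] at h1
    refine squeeze_zero' (Eventually.of_forall fun n =>
      div_nonneg (norm_nonneg _) (euclNorm_nonneg _)) ?_ h1
    filter_upwards [hκ] with n h2
    rw [le_inv_mul_iff₀ (by positivity), mul_comm]
    exact mul_le_mul_of_nonneg_left (pow_le_pow_left₀ hc.le h2 2)
      (div_nonneg (norm_nonneg _) (euclNorm_nonneg _))
  set w : ∀ n, Fin n → ℝ := fun n => (euclNorm (v n))⁻¹ • v n with hw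
  have hmax : Tendsto (fun n => ‖w n‖) atTop (𝓝 0) := by
    refine hratio.congr fun n => ?_
    rw [hw, norm_smul, norm_inv, Real.norm_of_nonneg (euclNorm_nonneg _), inv_mul_eq_div]
  have hw1 : ∀ᶠ n in atTop, w n ⬝ᵥ w n = 1 := by
    filter_upwards [hv0] with n h1
    have := euclNorm_pos h1
    simp only [hw, smul_dotProduct, dotProduct_smul, ← euclNorm_sq, smul_eq_mul]
    field_simp
  have hwY : ∀ᶠ n in atTop, w n ᵥ* scaledCov (φ n) (X n) = 0 := by
    filter_upwards [hv] with n h1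
    simp only [hw, scaledCov, Matrix.smul_vecMul, Matrix.vecMul_smul, h1, smul_zero]
  have hW : ∀ᶠ n in atTop, ∀ η : ℝ, 0 < η → η ≤ 1 / 2 → ∀ k₀ : ℕ, 0 < k₀ →
      32 * √(1 / c) ^ 2 * κ n ≤ k₀ →
      WalkBounds (augMatrix (φ n) (X n)) (scaledCov (φ n) (X n)) (φ n) (√(1 / c)) (κ n) η k₀ := by
    filter_upwards [hφ, hd, hX] with n h1 h2 h3 η hη hη2 k₀ hk hkκ
    exact walkBounds_augMatrix hc h1.1 h1.2 h2.1 h2.2 h3 hη hη2 hk hkκ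
  have hvarw : ∀ n, designVar (φ n) (X n) (w n)
      = designVar (φ n) (X n) (v n) / euclNorm (v n) ^ 2 := fun n => by
    rw [hw, designVar_smul, inv_pow, inv_mul_eq_div]
  have hvar : Tendsto (fun n => designVar (φ n) (X n) (v n) / euclNorm (v n) ^ 2)
      atTop (𝓝 1) := by
    refine (tendsto_variance hc hκ ht hW hw1 hwY).congr fun n => ?_
    rw [← designVar_eq, hvarw]
  refine ⟨⟨fun n => ((continuous_dotProduct_right (v n)).div_const _).aemeasurable,
    by fun_prop, ?_⟩, hvar⟩
  · refine ProbabilityMeasure.tendsto_iff_tendsto_charFun.2 fun t => ?_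
    have hθ : Tendsto (fun n => t / √(designVar (φ n) (X n) (w n))) atTop (𝓝 t) := by
      have h1 : Tendsto (fun n => √(designVar (φ n) (X n) (w n))) atTop (𝓝 1) := by
        have := (Real.continuous_sqrt.tendsto 1).comp hvar
        rw [Real.sqrt_one] at this
        refine this.congr fun n => ?_
        rw [hvarw]; rfl
      have h4 := (tendsto_const_nhds (x := t) (f := atTop)).div h1 one_ne_zero
      rw [div_one] at h4
      exact h4
    have h2 := tendsto_charFun hc hκ ht hW hw1 hwY hmax hθ
    have h3 : charFun ((gaussianReal 0 1).map (id : ℝ → ℝ)) t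
        = (Real.exp (-(t ^ 2 / 2)) : ℂ) := by
      rw [Measure.map_id, charFun_gaussianReal]
      push_cast
      congr 1
      simp
    simp only [ProbabilityMeasure.coe_mk]
    rw [h3]
    refine h2.congr' ?_
    filter_upwards [hv0] with n hn
    rw [← charFun_map_design]
    have hpos := euclNorm_pos hn
    congr 2
    ext z
    rw [hvarw, Real.sqrt_div' _ (sq_nonneg _), Real.sqrt_sq hpos.le]
    simp only [hw, dotProduct_smul, smul_eq_mul]
    by_cases h0 : √(designVar (φ n) (X n) (v n)) = 0
    · simp [h0]
    · field_simp
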